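/- All Lie algebras and representations are finite-dimensional. Let $\mathfrak g$ be a semisimple Lie algebra over $\mathbb Q$. A \emph{$\mathbb Q$-split torus} of $\mathfrak g$ is an abelian subalgebra all of whose elements are $\operatorname{ad}$-diagonalizable over $\mathbb Q$; a \emph{parabolic $\mathbb Q$-subalgebra} is a subalgebra $\mathfrak p\subseteq\mathfrak g$ such that $\mathfrak p\otimes_{\mathbb Q}\mathbb C$ contains a Borel (that is, maximal solvable) subalgebra of $\mathfrak g\otimes_{\mathbb Q}\mathbb C$. Let $\mathfrak t$ be a maximal $\mathbb Q$-split torus of $\mathfrak g$ and let $\mathfrak p\supseteq\mathfrak t$ be a minimal parabolic $\mathbb Q$-subalgebra. For $\alpha\in\mathfrak t^*=\operatorname{Hom}_{\mathbb Q}(\mathfrak t,\mathbb Q)$ put $\mathfrak g_\alpha=\{x\in\mathfrak g : [t,x]=\alpha(t)x \text{ for all } t\in\mathfrak t\}$, and let $\Phi_{\mathbb Q}=\{\alpha\ne 0:\mathfrak g_\alpha\neq 0\}$ be the system of $\mathbb Q$-roots, $\Phi^+_{\mathbb Q}=\{\alpha\in\Phi_{\mathbb Q}:\mathfrak g_\alpha\subseteq\mathfrak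 p\}$ the positive roots determined by $\mathfrak p$, and $\Delta_{\mathbb Q}$ the base of simple roots, i.e. the positive roots that are not a sum of two positive roots. Let $V$ be an irreducible real $\mathfrak g$-module (a nonzero real vector space with a $\mathbb Q$-linear Lie homomorphism $\mathfrak g\to\operatorname{End}_{\mathbb R}(V)$ and no $\mathfrak g$-invariant real subspaces other than $0$ and $V$). For $\mu:\mathfrak t\to\mathbb R$ let $V^\mu=\{v\in V: tv=\mu(t)v\text{ for all }t\in\mathfrak t\}$. Let $\lambda:\mathfrak t\to\mathbb Q$ be the highest weight of $V$ for the ordering determined by $\mathfrak p$: $\lambda$ is linear, $V^\lambda\ne0$, and every $\mu$ with $V^\mu\neq 0$ equals $\lambda$ minus a (possibly empty) sum of positive roots. A $\mathbb Q$-subspace of $V$ is a \emph{$\mathbb Q$-form} of a real subspace $W\subseteq V$ if it is the $\mathbb Q$-span of an $\mathbb R$-basis of $W$, and it is a \emph{$\mathbb Q$-form of the representation} $V$ if it is a $\mathbb Q$-form of the vector space $V$ and is $\mathfrak g$-invariant. Suppose that $U$ is a $\mathfrak p$-invariant $\mathbb Q$-form of the weight space $V^\lambda$. Then the representation $V$ has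 a $\mathbb Q$-form; indeed, the $\mathbb Q$-span of $$\{\,y_1y_2\cdots y_k w \;:\; k\ge 0,\ w\in U,\ y_j\in\mathfrak g_{-\alpha_j} \text{ with } \alpha_j\in\Delta_{\mathbb Q}\,\}$$ is a $\mathbb Q$-form of $V$. -/

import Mathlib

open scoped TensorProduct

attribute [local instance 100] LieRing.ofAssociativeRing

namespace QForm

section LieAlgebraSide

variable {𝔤 : Type*} [LieRing 𝔤] [LieAlgebra ℚ 𝔤]

/-- A `ℚ`-split torus of `𝔤`: an abelian subalgebra all of whose elements act diagonalizably
(over `ℚ`) on `𝔤` by the adjoint action. -/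
def IsSplitTorus (T : LieSubalgebra ℚ 𝔤) : Prop :=
  (∀ x ∈ T, ∀ y ∈ T, ⁅x, y⁆ = 0) ∧
    ∀ x ∈ T, ⨆ c : ℚ, Module.End.eigenspace (LieAlgebra.ad ℚ 𝔤 x) c = ⊤

/-- A maximal `ℚ`-split torus of `𝔤`. -/
def IsMaximalSplitTorus (T : LieSubalgebra ℚ 𝔤) : Prop :=
  Maximal IsSplitTorus T

/-- A Borel subalgebra of a complex Lie algebra: a maximal solvable subalgebra. -/
def IsBorel {L : Type*} [LieRing L] [LieAlgebra ℂ L] (B : LieSubalgebra ℂ L) : Prop :=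
  Maximal (fun S : LieSubalgebra ℂ L => LieAlgebra.IsSolvable S) B

/-- A parabolic `ℚ`-subalgebra of `𝔤`: a subalgebra whose complexification contains a Borel
subalgebra of `ℂ ⊗ 𝔤`. -/
def IsParabolic (P : LieSubalgebra ℚ 𝔤) : Prop :=
  ∃ B : LieSubalgebra ℂ (ℂ ⊗[ℚ] 𝔤), IsBorel B ∧ B.toSubmodule ≤ P.toSubmodule.baseChange ℂ

/-- A minimal parabolic `ℚ`-subalgebra of `𝔤`. -/
def IsMinimalParabolic (P : LieSubalgebra ℚ 𝔤) : Prop :=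
  Minimal IsParabolic P

/-- The simultaneous eigenspace `𝔤_α = {x | ∀ t ∈ T, [t, x] = α(t) x}`. -/
def rootSpace (T : LieSubalgebra ℚ 𝔤) (α : Module.Dual ℚ T) : Submodule ℚ 𝔤 :=
  ⨅ t : T, Module.End.eigenspace (LieAlgebra.ad ℚ 𝔤 (t : 𝔤)) (α t)

/-- The system `Φ_ℚ` of `ℚ`-roots of `(𝔤, T)`. -/
def rootSet (T : LieSubalgebra ℚ 𝔤) : Set (Module.Dual ℚ T) :=
  {α | α ≠ 0 ∧ rootSpace T α ≠ ⊥}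

/-- The `ℚ`-roots that are positive for the ordering determined by the parabolic `P`: those whose
root space lies in `P`. -/
def positiveRoots (T P : LieSubalgebra ℚ 𝔤) : Set (Module.Dual ℚ T) :=
  {α | α ∈ rootSet T ∧ rootSpace T α ≤ P.toSubmodule}

/-- The base `Δ_ℚ` of `Φ_ℚ` determined by `P`: the positive roots that are not the sum of two
positive roots. -/
def simpleRoots (T P : LieSubalgebra ℚ 𝔤) : Set (Module.Dual ℚ T) :=
  {α | α ∈ positiveRoots T P ∧
    ∀ β ∈ positiveRoots T P, ∀ γ ∈ positiveRoots T P, α ≠ β + γ}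

end LieAlgebraSide

section Representation

variable {V : Type*} [AddCommGroup V] [Module ℝ V] [Module ℚ V] [IsScalarTower ℚ ℝ V]

/-- `U` is a `ℚ`-form of the real subspace `W`: the `ℚ`-span of an `ℝ`-basis of `W`. -/
def IsRationalForm (W : Submodule ℝ V) (U : Submodule ℚ V) : Prop :=
  ∃ b : Set V, LinearIndepOn ℝ id b ∧ Submodule.span ℝ b = W ∧ Submodule.span ℚ b = U

variable {𝔤 : Type*} [LieRing 𝔤] [LieAlgebra ℚ 𝔤] (ρ : 𝔤 →ₗ⁅ℚ⁆ Module.End ℝ V)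

/-- `U` is a `ℚ`-form of the real representation `(ρ, V)` of `𝔤`: it is `𝔤`-invariant and it is
the `ℚ`-span of an `ℝ`-basis of `V`. -/
def IsRationalFormOfRep (U : Submodule ℚ V) : Prop :=
  (∀ x : 𝔤, ∀ u ∈ U, ρ x u ∈ U) ∧ IsRationalForm ⊤ U

/-- Irreducibility of the real representation `(ρ, V)`. -/
def IsIrreducibleRep : Prop :=
  Nontrivial V ∧
    ∀ W : Submodule ℝ V, (∀ x : 𝔤, ∀ w ∈ W, ρ x w ∈ W) → W = ⊥ ∨ W = ⊤

/-- The weight space `V^μ = {v | ∀ t ∈ T, t v = μ(t) v}`. -/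
noncomputable def weightSpace (T : LieSubalgebra ℚ 𝔤) (μ : T → ℝ) : Submodule ℝ V :=
  ⨅ t : T, Module.End.eigenspace (ρ (t : 𝔤)) (μ t)

/-- `l : T → ℚ` is the highest weight of `(ρ, V)` for the ordering determined by `P`: it is a
weight, and every weight is obtained from it by subtracting a sum of positive roots. -/
def IsHighestWeight (T P : LieSubalgebra ℚ 𝔤) (l : Module.Dual ℚ T) : Prop :=
  weightSpace ρ T (fun t => (l t : ℝ)) ≠ ⊥ ∧
    ∀ μ : T → ℝ, weightSpace ρ T μ ≠ ⊥ →
      ∃ s ∈ AddSubmonoid.closure (positiveRoots T P), ∀ t : T, μ t = ((l t - s t : ℚ) : ℝ)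

/-- The `ℚ`-span of all `y₁ y₂ ⋯ yₖ w` with `k ≥ 0`, `w ∈ U` and each `yⱼ` in a root space
`𝔤_{-α}` with `α` simple. -/
def negativeSpan (T P : LieSubalgebra ℚ 𝔤) (U : Submodule ℚ V) : Submodule ℚ V :=
  Submodule.span ℚ
    {v | ∃ (y : List 𝔤) (w : V), w ∈ U ∧
      (∀ z ∈ y, ∃ α ∈ simpleRoots T P, z ∈ rootSpace T (-α)) ∧
      v = (y.map ρ).prod w}

end Representation

end QForm

/-! Let `W` be the `ℚ`-span in question.

`W` is invariant: its stabilizer is a subalgebra of `𝔤`. It contains `𝔤_{-α}` for simple `α` by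
construction. It contains `𝔤_0`, because `𝔤_0 ⊆ 𝔭` preserves `U` and `[𝔤_0, 𝔤_{-α}] ⊆ 𝔤_{-α}`. It
contains `𝔤_α` for simple `α`, because `[𝔤_α, 𝔤_{-β}]` lies in `𝔤_0` if `β = α` and vanishes for any
other simple `β`. These spaces generate `𝔤` (`IsPositiveSystem.eq_top`).

`W` is a `ℚ`-form: the projection of `V` onto `V^λ` along the other weight spaces maps `W` into `U`.
Take the kernel of `ℝ ⊗ W → V`, contract it with `ℚ`-linear functionals on `ℝ`, and form the real
span of the resulting vectors of `W`. This span is `𝔤`-invariant and killed by the projection, so it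
is zero by irreducibility, and the map is injective (`IsIrreducibleRep.injective_liftBaseChange`).
Irreducibility also makes `W` span `V`.

The rest is relative root theory, derived from the definitions of torus and parabolic. Its engine is
the replica (`exists_replica`): for an additive `φ`, multiplying the generalized `μ`-eigenspace of
`ad x` by `φ μ` is a derivation, hence inner. With `φ` complex conjugation, it shows that elements
orthogonal to a Borel subalgebra are nilpotent. With `φ` the normalized trace to `ℚ`, it gives each
element of `𝔤_0` a replica in the maximal torus; so `𝔤_0` has no nonzero nilpotents, and root
vectors have coroots in the torus (`IsMaximalSplitTorus.exists_coroot`). Coroots and minimality of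
`𝔭` then make the roots in `𝔭` a positive system (`IsMinimalParabolic.isPositiveSystem`). -/

namespace QForm

/-! ### Lie's theorem and Cartan's criterion relative to the Killing form of the ambient algebra. -/

section Solvable

open LieModule

/-- An endomorphism that kills a submodule and is nilpotent modulo it is nilpotent. -/
lemma isNilpotent_of_quotient {K M : Type*} [Field K] [AddCommGroup M] [Module K M]
    (N : Submodule K M) (f : Module.End K M) (g : Module.End K (M ⧸ N))
    (hfg : ∀ m, N.mkQ (f m) = g (N.mkQ m)) (hN : ∀ m ∈ N, f m = 0) (hg : IsNilpotent g) :
    IsNilpotent f := by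
  obtain ⟨k, hk⟩ := hg
  refine ⟨k + 1, LinearMap.ext fun m ↦ ?_⟩
  have hpow : ∀ j, N.mkQ ((f ^ j) m) = (g ^ j) (N.mkQ m) := by
    intro j
    induction j with
    | zero => simp
    | succ j ih => rw [pow_succ', pow_succ', Module.End.mul_apply, Module.End.mul_apply, hfg, ih]
  rw [pow_succ', Module.End.mul_apply]
  refine hN _ ?_
  have := hpow k
  rwa [hk, LinearMap.zero_apply, Submodule.mkQ_apply, Submodule.Quotient.mk_eq_zero] at this

/-- By Lie's theorem the action is upper triangular. A commutator, or a product with a nilpotent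
factor, then has zero diagonal. The induction splits off the line of one common eigenvector, which
both operators kill. -/
theorem isNilpotent_toEnd_of_isSolvable {K L M : Type*} [Field K] [CharZero K] [IsAlgClosed K]
    [LieRing L] [LieAlgebra K L] [LieAlgebra.IsSolvable L] [AddCommGroup M] [Module K M]
    [LieRingModule L M] [LieModule K L M] [FiniteDimensional K M] :
    (∀ x y : L, IsNilpotent (toEnd K L M ⁅x, y⁆)) ∧
      ∀ n b : L, IsNilpotent (toEnd K L M n) → IsNilpotent (toEnd K L M n * toEnd K L M b) := by
  generalize hd : Module.finrank K M = d
  induction d using Nat.strong_induction_on generalizing M with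
  | _ d ih =>
  rcases subsingleton_or_nontrivial M with hM | hM
  · exact ⟨fun x y ↦ ⟨1, Subsingleton.elim _ _⟩, fun n b _ ↦ ⟨1, Subsingleton.elim _ _⟩⟩
  obtain ⟨χ, hχ⟩ := exists_nontrivial_weightSpace_of_isSolvable K L M
  obtain ⟨⟨v, hv⟩, hv0⟩ := exists_ne (0 : LieModule.weightSpace M χ)
  rw [LieModule.mem_weightSpace] at hv
  replace hv0 : v ≠ 0 := fun h ↦ hv0 (Subtype.ext h)
  let N : LieSubmodule K L M :=
    { toSubmodule := K ∙ v
      lie_mem := by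
        intro x m hm
        obtain ⟨c, rfl⟩ := Submodule.mem_span_singleton.mp hm
        rw [lie_smul, hv]
        exact Submodule.smul_mem _ _
          (Submodule.smul_mem _ _ (Submodule.mem_span_singleton_self v)) }
  have hN : ∀ m ∈ N.toSubmodule, ∃ c : K, c • v = m := fun m hm ↦ Submodule.mem_span_singleton.mp hm
  have hlt : Module.finrank K (M ⧸ N) < d := by
    have h1 := Submodule.finrank_quotient_add_finrank N.toSubmodule
    have h2 : Module.finrank K N.toSubmodule = 1 := finrank_span_singleton hv0
    have h3 : Module.finrank K (M ⧸ N) = Module.finrank K (M ⧸ N.toSubmodule) := rfl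
    omega
  obtain ⟨ih1, ih2⟩ := ih _ hlt (M := M ⧸ N) rfl
  have hmk : ∀ (x : L) (m : M), N.toSubmodule.mkQ (toEnd K L M x m) =
    toEnd K L (M ⧸ N) x (N.toSubmodule.mkQ m) := fun x m ↦ rfl
  refine ⟨fun x y ↦ ?_, fun n b hn ↦ ?_⟩
  · refine isNilpotent_of_quotient N.toSubmodule _ _ (hmk _) (fun m hm ↦ ?_) (ih1 x y)
    obtain ⟨c, rfl⟩ := hN m hm
    simp [hv, smul_smul, mul_comm]
  · have hχn : χ n = 0 := by
      obtain ⟨k, hk⟩ := hn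
      have hp : ∀ j : ℕ, (toEnd K L M n ^ j) v = χ n ^ j • v := by
        intro j
        induction j with
        | zero => simp
        | succ j ihj =>
          rw [pow_succ', Module.End.mul_apply, ihj, map_smul, toEnd_apply_apply, hv, smul_smul,
            pow_succ]
      have := hp k
      rw [hk, LinearMap.zero_apply] at this
      exact eq_zero_of_pow_eq_zero ((smul_eq_zero.mp this.symm).resolve_right hv0)
    have hnq : IsNilpotent (toEnd K L (M ⧸ N) n) := by
      obtain ⟨k, hk⟩ := hn
      refine ⟨k, LinearMap.ext fun q ↦ ?_⟩
      obtain ⟨m, rfl⟩ := N.toSubmodule.mkQ_surjective q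
      have hp : ∀ j : ℕ, (toEnd K L (M ⧸ N) n ^ j) (N.toSubmodule.mkQ m) =
          N.toSubmodule.mkQ ((toEnd K L M n ^ j) m) := by
        intro j
        induction j with
        | zero => simp
        | succ j ihj =>
          rw [pow_succ', pow_succ', Module.End.mul_apply, Module.End.mul_apply, ihj, hmk]
      rw [hp, hk]; simp
    refine isNilpotent_of_quotient N.toSubmodule _ (toEnd K L (M ⧸ N) n * toEnd K L (M ⧸ N) b)
      (fun m ↦ ?_) (fun m hm ↦ ?_) (ih2 n b hnq)
    · rw [Module.End.mul_apply, Module.End.mul_apply, hmk, hmk]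
    · obtain ⟨c, rfl⟩ := hN m hm
      simp [hv, hχn]

variable {K L : Type*} [Field K] [CharZero K] [LieRing L] [LieAlgebra K L]

/-- Elements of a solvable subalgebra that are nilpotent on `L` are Killing-orthogonal to it. -/
lemma killingForm_eq_zero_of_isNilpotent [IsAlgClosed K] [FiniteDimensional K L]
    (B : LieSubalgebra K L) [LieAlgebra.IsSolvable B] {n b : L} (hn : n ∈ B) (hb : b ∈ B)
    (hnil : IsNilpotent (LieAlgebra.ad K L n)) : killingForm K L n b = 0 := by
  have := (isNilpotent_toEnd_of_isSolvable (K := K) (L := B) (M := L)).2 ⟨n, hn⟩ ⟨b, hb⟩ hnil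
  exact (LinearMap.isNilpotent_trace_of_isNilpotent this).eq_zero

lemma isNilpotent_ad_lie_of_isSolvable [IsAlgClosed K] [FiniteDimensional K L]
    (B : LieSubalgebra K L) [LieAlgebra.IsSolvable B] {x y : L} (hx : x ∈ B) (hy : y ∈ B) :
    IsNilpotent (LieAlgebra.ad K L ⁅x, y⁆) :=
  (isNilpotent_toEnd_of_isSolvable (K := K) (L := B) (M := L)).1 ⟨x, hx⟩ ⟨y, hy⟩

lemma isSolvable_of_isSolvable_derivedSeries_one (K L : Type*) [Field K] [LieRing L]
    [LieAlgebra K L] (h : LieAlgebra.IsSolvable (LieAlgebra.derivedSeries K L 1)) :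
    LieAlgebra.IsSolvable L := by
  obtain ⟨k, hk⟩ := LieAlgebra.IsSolvable.solvable K (LieAlgebra.derivedSeries K L 1)
  rw [LieIdeal.derivedSeries_eq_bot_iff] at hk
  refine LieAlgebra.IsSolvable.mk (R := K) (k := k + 1) ?_
  rw [LieAlgebra.derivedSeries_def, LieAlgebra.derivedSeriesOfIdeal_add]
  exact hk

/-- Cartan's criterion for a subalgebra, in terms of the Killing form of the ambient algebra. -/
theorem isSolvable_of_killingForm_eq_zero [FiniteDimensional K L] (S : LieSubalgebra K L)
    (h : ∀ x ∈ S, ∀ y ∈ S, ∀ z ∈ S, killingForm K L x ⁅y, z⁆ = 0) : LieAlgebra.IsSolvable S := by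
  have hD : ∀ x ∈ S, ∀ y ∈ LieAlgebra.derivedSeries K S 1, killingForm K L x (y : L) = 0 := by
    intro x hx y hy
    have hle : (LieAlgebra.derivedSeries K S 1).toSubmodule ≤
        LinearMap.ker ((killingForm K L x) ∘ₗ S.toSubmodule.subtype) := by
      have hs := LieAlgebra.coe_derivedSeries_one_eq (R := K) (L := S)
      rw [show (LieAlgebra.derivedSeries K S 1).toSubmodule = _ from hs, Submodule.span_le]
      rintro _ ⟨a, b, rfl⟩
      exact h x hx a a.2 b b.2
    exact hle hy
  set D := LieAlgebra.derivedSeries K S 1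
  have htf : LieModule.traceForm K D L = 0 := by
    ext ⟨x, hx⟩ ⟨y, hy⟩
    exact hD x x.2 y hy
  -- Vanishing of the trace form makes `[D, D]` act nilpotently on `L`. As `[D, D]` sits inside `L`,
  -- Engel's theorem applies to it.
  have hnil := LieModule.isNilpotent_derivedSeries_of_traceForm_eq_zero htf
  have hDD : LieRing.IsNilpotent (LieAlgebra.derivedSeries K D 1) := by
    rw [LieAlgebra.isNilpotent_iff_forall (R := K)]
    intro x
    obtain ⟨k, hk⟩ := (LieModule.isNilpotent_iff_forall' (R := K)).mp hnil x
    refine ⟨k, LinearMap.ext fun y ↦ Subtype.ext (Subtype.ext (Subtype.ext ?_))⟩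
    have hp : ∀ j : ℕ, ((((LieAlgebra.ad K (LieAlgebra.derivedSeries K D 1) x ^ j) y :
        LieAlgebra.derivedSeries K D 1) : D) : S) =
        ((toEnd K (LieAlgebra.derivedSeries K D 1) L x ^ j) (((y : D) : S) : L)) := by
      intro j
      induction j with
      | zero => rfl
      | succ j ih =>
        rw [pow_succ', pow_succ', Module.End.mul_apply, Module.End.mul_apply, ← ih]
        rfl
    rw [hp, hk]; rfl
  have hDs : LieAlgebra.IsSolvable D := isSolvable_of_isSolvable_derivedSeries_one K D inferInstance
  exact isSolvable_of_isSolvable_derivedSeries_one K S hDs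

/-- A subalgebra is solvable if its brackets lie in a solvable subalgebra. -/
theorem isSolvable_of_lie_mem {K L : Type*} [Field K] [LieRing L] [LieAlgebra K L]
    {S B : LieSubalgebra K L} (hB : LieAlgebra.IsSolvable B)
    (h : ∀ x ∈ S, ∀ y ∈ S, ⁅x, y⁆ ∈ B) : LieAlgebra.IsSolvable S := by
  refine isSolvable_of_isSolvable_derivedSeries_one K S ?_
  have hD : ∀ x ∈ LieAlgebra.derivedSeries K S 1, (x : L) ∈ B := by
    have hle : (LieAlgebra.derivedSeries K S 1).toSubmodule ≤
        B.toSubmodule.comap S.toSubmodule.subtype := by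
      have hs := LieAlgebra.coe_derivedSeries_one_eq (R := K) (L := S)
      rw [show (LieAlgebra.derivedSeries K S 1).toSubmodule = _ from hs, Submodule.span_le]
      rintro _ ⟨a, b, rfl⟩
      exact h a a.2 b b.2
    exact fun x hx ↦ hle hx
  let f : LieAlgebra.derivedSeries K S 1 →ₗ⁅K⁆ B :=
    { toFun := fun x ↦ ⟨((x : S) : L), hD x x.2⟩
      map_add' := fun _ _ ↦ rfl
      map_smul' := fun _ _ ↦ rfl
      map_lie' := rfl }
  refine Function.Injective.lieAlgebra_isSolvable (f := f) fun a b hab ↦ ?_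
  exact Subtype.ext (Subtype.ext (show ((a : S) : L) = ((b : S) : L) from
    congrArg (fun u : B ↦ (u : L)) hab))

end Solvable

/-! ### Replicas: inner derivations that rescale generalized eigenspaces. -/

section Replica

variable {K : Type*} [Field K]

lemma exists_linearMap_smul_on_maxGenEigenspace {M : Type*} [AddCommGroup M] [Module K M]
    (f : Module.End K M) (hf : ⨆ μ, f.maxGenEigenspace μ = ⊤) (c : K → K) :
    ∃ D : Module.End K M, ∀ μ, ∀ v ∈ f.maxGenEigenspace μ, D v = c μ • v := by
  classical
  have hI := DirectSum.isInternal_submodule_of_iSupIndep_of_iSup_eq_top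
    f.independent_maxGenEigenspace hf
  let e := LinearEquiv.ofBijective (DirectSum.coeLinearMap fun μ ↦ f.maxGenEigenspace μ) hI
  refine ⟨DirectSum.toModule K K M (fun μ ↦ c μ • (f.maxGenEigenspace μ).subtype) ∘ₗ
    e.symm.toLinearMap, fun μ v hv ↦ ?_⟩
  have he : e.symm v = DirectSum.lof K K (fun μ ↦ f.maxGenEigenspace μ) μ ⟨v, hv⟩ := by
    rw [LinearEquiv.symm_apply_eq]
    exact (DirectSum.coeLinearMap_lof (fun μ ↦ f.maxGenEigenspace μ) μ ⟨v, hv⟩).symm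
  simp [he]

variable {L : Type*} [LieRing L] [LieAlgebra K L]

/-- If `ad x` is triangularizable and `φ` is an additive map of the ground field, there is an
element acting as the scalar `φ μ` on each generalized `μ`-eigenspace of `ad x`. -/
theorem exists_replica [FiniteDimensional K L] [LieAlgebra.IsKilling K L] (x : L)
    (hx : ⨆ μ, (LieAlgebra.ad K L x).maxGenEigenspace μ = ⊤) (φ : K →+ K) :
    ∃ y : L, ∀ μ, ∀ v ∈ (LieAlgebra.ad K L x).maxGenEigenspace μ, ⁅y, v⁆ = φ μ • v := by
  obtain ⟨D, hD⟩ := exists_linearMap_smul_on_maxGenEigenspace _ hx φ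
  -- The bracket adds eigenvalues and `φ` is additive, so `D` is a derivation.
  have hder : ∀ a b : L, D ⁅a, b⁆ = ⁅a, D b⁆ - ⁅b, D a⁆ := by
    intro a b
    have ha : a ∈ ⨆ μ, (LieAlgebra.ad K L x).maxGenEigenspace μ := hx ▸ Submodule.mem_top
    have hb : b ∈ ⨆ μ, (LieAlgebra.ad K L x).maxGenEigenspace μ := hx ▸ Submodule.mem_top
    induction ha using Submodule.iSup_induction' with
    | zero => simp
    | add a a' _ _ h h' => simp only [add_lie, lie_add, map_add, h, h']; abel
    | mem μ a ha =>
      induction hb using Submodule.iSup_induction' with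
      | zero => simp
      | add a a' _ _ h h' => simp only [add_lie, lie_add, map_add, h, h']; abel
      | mem ν b hb =>
        have hab : ⁅a, b⁆ ∈ (LieAlgebra.ad K L x).maxGenEigenspace (μ + ν) :=
          LieModule.lie_mem_maxGenEigenspace_toEnd ha hb
        rw [hD _ _ hab, hD _ _ ha, hD _ _ hb, lie_smul, lie_smul, ← lie_skew b a, map_add,
          add_smul, smul_neg, sub_neg_eq_add, add_comm]
  obtain ⟨y, hy⟩ := LieDerivation.IsKilling.exists_eq_ad
    (⟨D, hder⟩ : LieDerivation K L L)
  refine ⟨y, fun μ v hv ↦ ?_⟩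
  rw [← hD μ v hv]
  simpa using congr($hy v)

end Replica

/-! ### The trace of an endomorphism composed with a replica. -/

section TraceReplica

variable {K M : Type*} [Field K] [AddCommGroup M] [Module K M] [FiniteDimensional K M]

/-- On each generalized eigenspace `f` is `μ` plus a nilpotent, and only `μ` contributes to the
trace. -/
lemma trace_comp_of_smul_on_maxGenEigenspace (f D : Module.End K M) (c : K → K)
    (hf : ⨆ μ, f.maxGenEigenspace μ = ⊤)
    (hD : ∀ μ, ∀ v ∈ f.maxGenEigenspace μ, D v = c μ • v)
    (hfin : {μ | f.maxGenEigenspace μ ≠ ⊥}.Finite) :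
    LinearMap.trace K M (f ∘ₗ D) =
      ∑ μ ∈ hfin.toFinset, c μ * μ * (Module.finrank K (f.maxGenEigenspace μ) : K) := by
  classical
  have hI := DirectSum.isInternal_submodule_of_iSupIndep_of_iSup_eq_top
    f.independent_maxGenEigenspace hf
  have hfm : ∀ μ, Set.MapsTo f (f.maxGenEigenspace μ) (f.maxGenEigenspace μ) := fun μ ↦
    f.mapsTo_maxGenEigenspace_of_comm rfl μ
  have hm : ∀ μ, Set.MapsTo (f ∘ₗ D) (f.maxGenEigenspace μ) (f.maxGenEigenspace μ) := by
    intro μ v hv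
    rw [LinearMap.comp_apply, hD μ v hv]
    exact hfm μ (Submodule.smul_mem _ _ hv)
  rw [LinearMap.trace_eq_sum_trace_restrict' hI hfin hm]
  refine Finset.sum_congr rfl fun μ _ ↦ ?_
  have h1 : (f ∘ₗ D).restrict (hm μ) = c μ • f.restrict (hfm μ) := by
    ext ⟨v, hv⟩
    change f (D v) = c μ • f v
    rw [hD μ v hv, map_smul]
  have h2 := LinearMap.trace_comp_eq_mul_of_commute_of_isNilpotent (f := 1)
    (g := f.restrict (hfm μ)) μ (Commute.one_left _)
    (f.isNilpotent_restrict_maxGenEigenspace_sub_algebraMap μ)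
  rw [← Module.End.mul_eq_comp, one_mul, LinearMap.trace_one] at h2
  rw [h1, map_smul, h2, smul_eq_mul, mul_assoc]

end TraceReplica

/-! ### Borel subalgebras and their Killing-orthogonals. -/

section Borel

variable {L : Type*} [LieRing L] [LieAlgebra ℂ L]

/-- The subalgebra `B + ℂ x`, when `[b, x] ∈ ℂ x + B` for all `b ∈ B`. -/
def adjoinElement (B : LieSubalgebra ℂ L) (x : L)
    (h : ∀ b ∈ B, ∃ c : ℂ, ⁅b, x⁆ - c • x ∈ B) : LieSubalgebra ℂ L where
  toSubmodule := B.toSubmodule ⊔ ℂ ∙ x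
  lie_mem' := by
    intro u v hu hv
    obtain ⟨b, hb, _, hx, rfl⟩ := Submodule.mem_sup.mp hu
    obtain ⟨b', hb', _, hx', rfl⟩ := Submodule.mem_sup.mp hv
    obtain ⟨c, rfl⟩ := Submodule.mem_span_singleton.mp hx
    obtain ⟨c', rfl⟩ := Submodule.mem_span_singleton.mp hx'
    obtain ⟨d, hd⟩ := h b hb
    obtain ⟨d', hd'⟩ := h b' hb'
    refine Submodule.mem_sup.mpr ⟨⁅b, b'⁆ + c' • (⁅b, x⁆ - d • x) - c • (⁅b', x⁆ - d' • x),
      B.sub_mem (B.add_mem (B.lie_mem hb hb') (B.smul_mem _ hd)) (B.smul_mem _ hd'),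
      (c' * d - c * d') • x, Submodule.smul_mem _ _ (Submodule.mem_span_singleton_self x), ?_⟩
    simp only [add_lie, lie_add, smul_lie, lie_smul, lie_self, smul_zero, smul_sub, sub_smul,
      mul_smul, ← lie_skew x b', smul_neg]
    module

lemma mem_adjoinElement {B : LieSubalgebra ℂ L} {x : L}
    {h : ∀ b ∈ B, ∃ c : ℂ, ⁅b, x⁆ - c • x ∈ B} {u : L} :
    u ∈ adjoinElement B x h ↔ ∃ b ∈ B, ∃ c : ℂ, b + c • x = u := by
  change u ∈ B.toSubmodule ⊔ ℂ ∙ x ↔ _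
  simp only [Submodule.mem_sup, Submodule.mem_span_singleton, exists_exists_eq_and]
  rfl

lemma IsBorel.mem_of_isSolvable {B : LieSubalgebra ℂ L} (hB : IsBorel B) {x : L}
    {h : ∀ b ∈ B, ∃ c : ℂ, ⁅b, x⁆ - c • x ∈ B}
    (hs : LieAlgebra.IsSolvable (adjoinElement B x h)) : x ∈ B := by
  have hle : B ≤ adjoinElement B x h := fun b hb ↦
    mem_adjoinElement.mpr ⟨b, hb, 0, by simp⟩
  exact hB.2 hs hle (mem_adjoinElement.mpr ⟨0, B.zero_mem, 1, by simp⟩)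

lemma exists_isBorel_ge [FiniteDimensional ℂ L] (S : LieSubalgebra ℂ L)
    (hS : LieAlgebra.IsSolvable S) : ∃ B, IsBorel B ∧ S ≤ B := by
  obtain ⟨B, hSB, hB⟩ := exists_maximal_ge_of_wellFoundedGT
    (fun S : LieSubalgebra ℂ L ↦ LieAlgebra.IsSolvable S) S hS
  exact ⟨B, hB, hSB⟩

lemma killingForm_lie {K L : Type*} [CommRing K] [LieRing L] [LieAlgebra K L] (x y z : L) :
    killingForm K L ⁅x, y⁆ z = killingForm K L x ⁅y, z⁆ :=
  LieModule.traceForm_apply_lie_apply K L L x y z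

variable [FiniteDimensional ℂ L]

/-- A Borel subalgebra contains its Killing-orthogonal. -/
theorem IsBorel.mem_of_orthogonal {B : LieSubalgebra ℂ L} (hB : IsBorel B) {z : L}
    (hz : ∀ b ∈ B, killingForm ℂ L z b = 0) : z ∈ B := by
  by_contra hzB
  have : LieAlgebra.IsSolvable B := hB.1
  let BM : LieSubmodule ℂ B L :=
    { toSubmodule := B.toSubmodule
      lie_mem := fun {x m} hm ↦ B.lie_mem x.2 hm }
  let OM : LieSubmodule ℂ B L :=
    { carrier := {y | ∀ b ∈ B, killingForm ℂ L y b = 0}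
      add_mem' := fun {u v} hu hv b hb ↦ by
        rw [map_add, LinearMap.add_apply, hu b hb, hv b hb, add_zero]
      zero_mem' := fun b _ ↦ by simp
      smul_mem' := fun c u hu b hb ↦ by
        rw [map_smul, LinearMap.smul_apply, hu b hb, smul_zero]
      lie_mem := fun {x m} hm b hb ↦ by
        have : ⁅x, m⁆ = -⁅m, (x : L)⁆ := (lie_skew _ _).symm
        rw [this, map_neg, LinearMap.neg_apply, killingForm_lie, hm _ (B.lie_mem x.2 hb),
          neg_zero] }
  let q : L →ₗ⁅ℂ, B⁆ L ⧸ BM := LieSubmodule.Quotient.mk' BM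
  -- If the orthogonal of `B` is not inside `B`, its image in `L / B` is a nonzero `B`-module. A
  -- common eigenvector there lifts to `x ∉ B` orthogonal to `B`, with `B + ℂ x` a subalgebra.
  -- Cartan's criterion makes it solvable, against maximality.
  let N : LieSubmodule ℂ B (L ⧸ BM) := OM.map q
  have hq : ∀ u, q u = 0 ↔ u ∈ B := fun u ↦ LieSubmodule.Quotient.mk_eq_zero'
  have : Nontrivial N := by
    refine ⟨⟨⟨q z, LieSubmodule.mem_map_of_mem hz⟩, 0, fun h ↦ hzB ?_⟩⟩
    exact (hq z).mp (congrArg Subtype.val h)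
  obtain ⟨χ, hχ⟩ := LieModule.exists_nontrivial_weightSpace_of_isSolvable ℂ B N
  obtain ⟨⟨⟨n, hnN⟩, hn⟩, hn0⟩ := exists_ne (0 : LieModule.weightSpace N χ)
  obtain ⟨x, hx, rfl⟩ := (LieSubmodule.mem_map _).mp hnN
  rw [LieModule.mem_weightSpace] at hn
  have hxB : x ∉ B := fun h ↦ hn0 (Subtype.ext (Subtype.ext ((hq x).mpr h)))
  have hadj : ∀ b ∈ B, ∃ c : ℂ, ⁅b, x⁆ - c • x ∈ B := by
    intro b hb
    refine ⟨χ ⟨b, hb⟩, (hq _).mp ?_⟩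
    have h1 : ⁅(⟨b, hb⟩ : B), q x⁆ = χ ⟨b, hb⟩ • q x := congrArg Subtype.val (hn ⟨b, hb⟩)
    rw [map_sub, map_smul, ← h1, ← LieModuleHom.map_lie]
    exact sub_self _
  refine hxB (hB.mem_of_isSolvable (h := hadj) (isSolvable_of_killingForm_eq_zero _ ?_))
  have hBB : ∀ a ∈ B, ∀ b ∈ B, ∀ c ∈ B, killingForm ℂ L a ⁅b, c⁆ = 0 := fun a ha b hb c hc ↦ by
    rw [LieModule.traceForm_comm]
    exact killingForm_eq_zero_of_isNilpotent B (B.lie_mem hb hc) ha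
      (isNilpotent_ad_lie_of_isSolvable B hb hc)
  have hxx : ∀ b ∈ B, killingForm ℂ L x b = 0 := hx
  have hxx' : ∀ b ∈ B, killingForm ℂ L b x = 0 := fun b hb ↦ by
    rw [LieModule.traceForm_comm]; exact hx b hb
  have h1 : ∀ a ∈ B, ∀ b ∈ B, killingForm ℂ L a ⁅b, x⁆ = 0 := fun a ha b hb ↦ by
    rw [← killingForm_lie]; exact hxx' _ (B.lie_mem ha hb)
  have h2 : ∀ b ∈ B, killingForm ℂ L x ⁅b, x⁆ = 0 := fun b hb ↦ by
    rw [← lie_skew, map_neg, ← killingForm_lie, lie_self]; simp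
  intro u hu v hv w hw
  obtain ⟨a, ha, r, rfl⟩ := mem_adjoinElement.mp hu
  obtain ⟨b, hb, s, rfl⟩ := mem_adjoinElement.mp hv
  obtain ⟨c, hc, t, rfl⟩ := mem_adjoinElement.mp hw
  have : ⁅b + s • x, c + t • x⁆ = ⁅b, c⁆ + t • ⁅b, x⁆ - s • ⁅c, x⁆ := by
    simp only [add_lie, lie_add, smul_lie, lie_smul, lie_self, smul_zero, ← lie_skew x c, smul_neg]
    module
  simp only [this, map_add, map_sub, map_smul, LinearMap.add_apply, LinearMap.smul_apply,
    hBB a ha b hb c hc, hxx _ (B.lie_mem hb hc), h1 a ha b hb, h1 a ha c hc, h2 b hb, h2 c hc]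
  simp

/-- Elements Killing-orthogonal to a Borel subalgebra are `ad`-nilpotent. -/
theorem IsBorel.isNilpotent_ad_of_orthogonal [LieAlgebra.IsKilling ℂ L] {B : LieSubalgebra ℂ L}
    (hB : IsBorel B) {x : L} (hx : ∀ b ∈ B, killingForm ℂ L x b = 0) :
    IsNilpotent (LieAlgebra.ad ℂ L x) := by
  have hxB := hB.mem_of_orthogonal hx
  have htop := Module.End.iSup_maxGenEigenspace_eq_top (LieAlgebra.ad ℂ L x)
  -- The replica `y` acts by the conjugate eigenvalues. It normalizes `B`, because the `ad x`-stable
  -- space `B` is graded by generalized eigenspaces; so `y ∈ B` by maximality. Then `0 = κ(x, y)` is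
  -- the sum of `|μ|²` over the eigenvalues with multiplicity, and all of them vanish.
  obtain ⟨y, hy⟩ := exists_replica x htop (starRingEnd ℂ : ℂ →+ ℂ)
  have hyB : ∀ b ∈ B, ⁅b, y⁆ ∈ B := by
    intro b hb
    have hinv : ∀ b ∈ B.toSubmodule, LieAlgebra.ad ℂ L x b ∈ B.toSubmodule :=
      fun b hb ↦ B.lie_mem hxB hb
    have hdec := Submodule.eq_iSup_inf_genEigenspace ⊤ hinv htop
    have hb' : b ∈ ⨆ μ, B.toSubmodule ⊓ (LieAlgebra.ad ℂ L x).maxGenEigenspace μ := hdec ▸ hb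
    rw [← lie_skew]
    refine B.neg_mem ?_
    clear hb
    induction hb' using Submodule.iSup_induction' with
    | mem μ v hv => rw [hy μ v hv.2]; exact B.smul_mem _ hv.1
    | zero => simp
    | add u v _ _ hu hv => rw [lie_add]; exact B.add_mem hu hv
  have hyB' : y ∈ B := by
    refine hB.mem_of_isSolvable (h := fun b hb ↦ ⟨0, by simpa using hyB b hb⟩)
      (isSolvable_of_lie_mem hB.1 ?_)
    intro u hu v hv
    obtain ⟨a, ha, r, rfl⟩ := mem_adjoinElement.mp hu
    obtain ⟨b, hb, s, rfl⟩ := mem_adjoinElement.mp hv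
    have : ⁅a + r • y, b + s • y⁆ = ⁅a, b⁆ + s • ⁅a, y⁆ - r • ⁅b, y⁆ := by
      simp only [add_lie, lie_add, smul_lie, lie_smul, lie_self, smul_zero, ← lie_skew y b,
        smul_neg]
      module
    rw [this]
    exact B.sub_mem (B.add_mem (B.lie_mem ha hb) (B.smul_mem _ (hyB a ha)))
      (B.smul_mem _ (hyB b hb))
  have htr := hx y hyB'
  have hfin : {μ | (LieAlgebra.ad ℂ L x).maxGenEigenspace μ ≠ ⊥}.Finite :=
    WellFoundedGT.finite_ne_bot_of_iSupIndep (LieAlgebra.ad ℂ L x).independent_maxGenEigenspace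
  rw [killingForm_apply_apply, trace_comp_of_smul_on_maxGenEigenspace _ _ _ htop hy hfin] at htr
  have hsum : ∑ μ ∈ hfin.toFinset, Complex.normSq μ *
      (Module.finrank ℂ ((LieAlgebra.ad ℂ L x).maxGenEigenspace μ) : ℝ) = 0 := by
    have : ∀ μ : ℂ, (starRingEnd ℂ : ℂ →+ ℂ) μ * μ = (Complex.normSq μ : ℂ) := fun μ ↦ by
      rw [Complex.normSq_eq_conj_mul_self]; rfl
    simp only [this] at htr
    exact_mod_cast htr
  have hzero : ∀ μ ≠ 0, (LieAlgebra.ad ℂ L x).maxGenEigenspace μ = ⊥ := by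
    intro μ hμ
    by_contra hne
    have h0 := (Finset.sum_eq_zero_iff_of_nonneg (fun ν _ ↦
      mul_nonneg (Complex.normSq_nonneg ν) (Nat.cast_nonneg _))).mp hsum μ (by simpa using hne)
    rcases mul_eq_zero.mp h0 with h | h
    · exact hμ (Complex.normSq_eq_zero.mp h)
    · rw [Nat.cast_eq_zero, Submodule.finrank_eq_zero] at h
      exact hne h
  have h0 : (LieAlgebra.ad ℂ L x).maxGenEigenspace 0 = ⊤ := by
    rw [← htop]
    refine le_antisymm (le_iSup _ 0) (iSup_le fun μ ↦ ?_)
    rcases eq_or_ne μ 0 with rfl | hμ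
    · exact le_rfl
    · rw [hzero μ hμ]; exact bot_le
  refine ⟨Module.finrank ℂ L, LinearMap.ext fun v ↦ ?_⟩
  have hv : v ∈ (LieAlgebra.ad ℂ L x).maxGenEigenspace 0 := h0 ▸ Submodule.mem_top
  rw [Module.End.maxGenEigenspace_eq_genEigenspace_finrank, Module.End.mem_genEigenspace_nat] at hv
  simpa using hv

end Borel

/-! ### Diagonalizability criteria. -/

section Diagonalizable

open Polynomial

variable {K M : Type*} [Field K] [AddCommGroup M] [Module K M]

lemma iSup_eigenspace_eq_top_of_aeval_prod (f : Module.End K M) (s : Finset K)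
    (h : aeval f (∏ c ∈ s, (X - C c)) = 0) : ⨆ c, f.eigenspace c = ⊤ := by
  classical
  have key : ∀ t : Finset K, LinearMap.ker (aeval f (∏ c ∈ t, (X - C c))) ≤
      ⨆ c, f.eigenspace c := by
    intro t
    induction t using Finset.induction_on with
    | empty => simp [Module.End.one_eq_id]
    | insert c t hc ih =>
      rw [Finset.prod_insert hc, ← sup_ker_aeval_eq_ker_aeval_mul_of_coprime]
      · refine sup_le ?_ ih
        refine le_trans (le_of_eq ?_) (le_iSup _ c)
        ext v
        simp [sub_eq_zero]
      · refine IsCoprime.prod_right fun d hd ↦ isCoprime_X_sub_C_of_isUnit_sub ?_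
        exact (sub_ne_zero.mpr fun h ↦ hc (by rwa [h])).isUnit
  rw [eq_top_iff]
  intro v _
  exact key s (by simp [h])

lemma iSup_eigenspace_add_eq_top [FiniteDimensional K M] {f g : Module.End K M} (hfg : Commute f g)
    (hf : ⨆ c, f.eigenspace c = ⊤) (hg : ⨆ c, g.eigenspace c = ⊤) :
    ⨆ c, (f + g).eigenspace c = ⊤ := by
  rw [eq_top_iff, ← hf]
  refine iSup_le fun μ ↦ ?_
  have hinv : ∀ v ∈ f.eigenspace μ, g v ∈ f.eigenspace μ := fun v hv ↦
    Module.End.mapsTo_genEigenspace_of_comm hfg μ 1 hv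
  rw [Submodule.eq_iSup_inf_genEigenspace (f := g) 1 hinv hg]
  refine iSup_le fun ν ↦ le_trans (fun v hv ↦ ?_) (le_iSup _ (μ + ν))
  rw [Submodule.mem_inf] at hv
  have h1 := Module.End.mem_eigenspace_iff.mp hv.1
  have h2 := Module.End.mem_eigenspace_iff.mp hv.2
  rw [Module.End.mem_eigenspace_iff, LinearMap.add_apply, h1, h2, add_smul]

lemma iSup_eigenspace_smul_eq_top {f : Module.End K M}
    (hf : ⨆ c, f.eigenspace c = ⊤) (a : K) : ⨆ c, (a • f).eigenspace c = ⊤ := by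
  rw [eq_top_iff, ← hf]
  refine iSup_le fun μ ↦ le_trans (fun v hv ↦ ?_) (le_iSup _ (a * μ))
  rw [Module.End.mem_eigenspace_iff] at hv ⊢
  rw [LinearMap.smul_apply, hv, smul_smul]

end Diagonalizable

/-! ### The Killing form under extension of scalars from `ℚ`. -/

section BaseChange

variable {K : Type*} [Field K] [Algebra ℚ K] {𝔤 : Type*} [LieRing 𝔤] [LieAlgebra ℚ 𝔤]
  [FiniteDimensional ℚ 𝔤]

lemma killingForm_tmul (a b : K) (x y : 𝔤) :
    killingForm K (K ⊗[ℚ] 𝔤) (a ⊗ₜ x) (b ⊗ₜ y) =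
      (a * b) * algebraMap ℚ K (killingForm ℚ 𝔤 x y) := by
  rw [killingForm, LieModule.traceForm_baseChange, LinearMap.BilinForm.baseChange_tmul,
    Algebra.smul_def]
  ring

/-- Pairing with the rational dual basis reads off the coefficients of an element, so a radical
element has none. -/
instance isKilling_baseChange [LieAlgebra.IsKilling ℚ 𝔤] : LieAlgebra.IsKilling K (K ⊗[ℚ] 𝔤) where
  killingCompl_top_eq_bot := by
    rw [LieSubmodule.eq_bot_iff]
    intro x hx
    rw [LieIdeal.mem_killingCompl] at hx
    let b := Module.finBasis ℚ 𝔤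
    obtain ⟨c, rfl⟩ := TensorProduct.eq_repr_basis_right b x
    have hnd := LieAlgebra.IsKilling.killingForm_nondegenerate ℚ 𝔤
    let b' := (killingForm ℚ 𝔤).dualBasis hnd b
    have hc : c = 0 := by
      ext i
      have h := hx (1 ⊗ₜ b' i) (LieSubmodule.mem_top _)
      rw [Finsupp.sum, map_sum,
        Finset.sum_congr rfl fun j _ ↦ killingForm_tmul 1 (c j) (b' i) (b j)]
        at h
      simp only [b', LinearMap.BilinForm.apply_dualBasis_left] at h
      simpa using h
    simp [hc]

omit [FiniteDimensional ℚ 𝔤] in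
lemma isNilpotent_of_isNilpotent_ad_tmul {x : 𝔤}
    (h : IsNilpotent (LieAlgebra.ad K (K ⊗[ℚ] 𝔤) (1 ⊗ₜ x))) :
    IsNilpotent (LieAlgebra.ad ℚ 𝔤 x) := by
  have hinj : Function.Injective (Module.End.baseChangeHom ℚ K 𝔤) :=
    LinearMap.baseChangeHom_injective ℚ 𝔤 K
  rw [← IsNilpotent.map_iff hinj]
  have : Module.End.baseChangeHom ℚ K 𝔤 (LieAlgebra.ad ℚ 𝔤 x) =
    LieAlgebra.ad K (K ⊗[ℚ] 𝔤) (1 ⊗ₜ x) := (LieModule.toEnd_baseChange ..).symm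
  rwa [this]

omit [FiniteDimensional ℚ 𝔤] in
lemma isNilpotent_ad_tmul {x : 𝔤} (h : IsNilpotent (LieAlgebra.ad ℚ 𝔤 x)) :
    IsNilpotent (LieAlgebra.ad K (K ⊗[ℚ] 𝔤) (1 ⊗ₜ x)) := by
  have : Module.End.baseChangeHom ℚ K 𝔤 (LieAlgebra.ad ℚ 𝔤 x) =
    LieAlgebra.ad K (K ⊗[ℚ] 𝔤) (1 ⊗ₜ x) := (LieModule.toEnd_baseChange ..).symm
  rw [← this]
  exact h.map _

omit [LieRing 𝔤] [LieAlgebra ℚ 𝔤] [FiniteDimensional ℚ 𝔤] in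
lemma mem_of_tmul_mem_baseChange [AddCommGroup 𝔤] [Module ℚ 𝔤] {Q : Submodule ℚ 𝔤} {x : 𝔤}
    (hx : (1 : K) ⊗ₜ[ℚ] x ∈ Q.baseChange K) : x ∈ Q := by
  by_contra hxQ
  obtain ⟨f, hfx, hfQ⟩ := Submodule.exists_le_ker_of_notMem hxQ
  have : Q.baseChange K ≤ LinearMap.ker (f.baseChange K) := by
    rw [Submodule.baseChange_eq_span, Submodule.span_le]
    rintro _ ⟨y, hy, rfl⟩
    have := hfQ hy
    simp_all
  have h := this hx
  rw [LinearMap.mem_ker, LinearMap.baseChange_tmul] at h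
  have h2 := congrArg (TensorProduct.rid ℚ K) h
  simp [hfx] at h2

/-- Double orthogonality over `K`, tested on rational elements only. Expand `b` along a `ℚ`-basis of
`K`: a coefficient outside `Q` is detected by a functional vanishing on `Q`, which is the pairing
with some `n`. The vanishing of that pairing with `b` is a `ℚ`-linear relation between basis
elements of `K`. -/
lemma mem_baseChange_of_orthogonal [LieAlgebra.IsKilling ℚ 𝔤] {Q : Submodule ℚ 𝔤} {b : K ⊗[ℚ] 𝔤}
    (hb : ∀ n : 𝔤, (∀ q ∈ Q, killingForm ℚ 𝔤 n q = 0) →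
      killingForm K (K ⊗[ℚ] 𝔤) (1 ⊗ₜ n) b = 0) : b ∈ Q.baseChange K := by
  let B := Module.Basis.ofVectorSpace ℚ K
  obtain ⟨c, rfl⟩ := TensorProduct.eq_repr_basis_left B b
  refine Submodule.sum_mem _ fun i _ ↦ ?_
  refine Submodule.tmul_mem_baseChange_of_mem _ ?_
  by_contra hi
  obtain ⟨f, hfx, hfQ⟩ := Submodule.exists_le_ker_of_notMem hi
  have hnd := LieAlgebra.IsKilling.killingForm_nondegenerate ℚ 𝔤
  obtain ⟨n, hn⟩ := ((killingForm ℚ 𝔤).toDual hnd).surjective f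
  have hn' : ∀ y, killingForm ℚ 𝔤 n y = f y := fun y ↦ by
    rw [← hn, LinearMap.BilinForm.toDual_def]
  have h := hb n fun q hq ↦ by rw [hn']; exact hfQ hq
  rw [Finsupp.sum, map_sum, Finset.sum_congr rfl fun j _ ↦ killingForm_tmul 1 (B j) n (c j)] at h
  have h3 : ∑ j ∈ c.support, f (c j) • B j = 0 := by
    rw [← h]
    exact Finset.sum_congr rfl fun j _ ↦ by rw [hn', Algebra.smul_def, one_mul, mul_comm]
  have hlin := linearIndependent_iff'.mp B.linearIndependent c.support (fun j ↦ f (c j)) h3 i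
  refine hfx (hlin ?_)
  rw [Finsupp.mem_support_iff]
  intro h0
  rw [h0] at hi
  exact hi Q.zero_mem

end BaseChange

/-! ### Galois descent and rational replicas. -/

section RationalReplica

variable {𝔤 : Type*} [LieRing 𝔤] [LieAlgebra ℚ 𝔤]

/-- The semilinear action of an automorphism of `K` on `K ⊗ 𝔤`. -/
noncomputable def galoisMap {K : Type*} [Field K] [Algebra ℚ K] (σ : K ≃ₐ[ℚ] K) :
    K ⊗[ℚ] 𝔤 →ₗ[ℚ] K ⊗[ℚ] 𝔤 :=
  LinearMap.rTensor 𝔤 σ.toLinearMap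

variable {K : Type*} [Field K] [Algebra ℚ K] (σ : K ≃ₐ[ℚ] K)

@[simp] lemma galoisMap_tmul (a : K) (x : 𝔤) : galoisMap σ (a ⊗ₜ x) = σ a ⊗ₜ[ℚ] x := rfl

lemma galoisMap_smul (c : K) (v : K ⊗[ℚ] 𝔤) : galoisMap σ (c • v) = σ c • galoisMap σ v := by
  induction v with
  | zero => simp
  | add a b ha hb => rw [smul_add, map_add, ha, hb, map_add, smul_add]
  | tmul a x => simp [TensorProduct.smul_tmul']

lemma galoisMap_lie (u v : K ⊗[ℚ] 𝔤) : galoisMap σ ⁅u, v⁆ = ⁅galoisMap σ u, galoisMap σ v⁆ := by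
  induction u with
  | zero => simp
  | add a b ha hb => rw [add_lie, map_add, ha, hb, map_add, add_lie]
  | tmul a x =>
    induction v with
    | zero => simp
    | add a b ha hb => rw [lie_add, map_add, ha, hb, map_add, lie_add]
    | tmul b y => simp [LieAlgebra.ExtendScalars.bracket_tmul]

lemma galoisMap_symm (v : K ⊗[ℚ] 𝔤) : galoisMap σ (galoisMap σ.symm v) = v := by
  induction v with
  | zero => simp
  | add a b ha hb => rw [map_add, map_add, ha, hb]
  | tmul a x => simp

lemma galoisMap_mem_maxGenEigenspace (h : 𝔤) {μ : K} {v : K ⊗[ℚ] 𝔤}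
    (hv : v ∈ (LieAlgebra.ad K (K ⊗[ℚ] 𝔤) (1 ⊗ₜ h)).maxGenEigenspace μ) :
    galoisMap σ v ∈ (LieAlgebra.ad K (K ⊗[ℚ] 𝔤) (1 ⊗ₜ h)).maxGenEigenspace (σ μ) := by
  rw [Module.End.mem_maxGenEigenspace] at hv ⊢
  obtain ⟨k, hk⟩ := hv
  refine ⟨k, ?_⟩
  have hp : ∀ (j : ℕ) (w : K ⊗[ℚ] 𝔤),
      ((LieAlgebra.ad K (K ⊗[ℚ] 𝔤) (1 ⊗ₜ h) - σ μ • 1) ^ j) (galoisMap σ w) =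
      galoisMap σ (((LieAlgebra.ad K (K ⊗[ℚ] 𝔤) (1 ⊗ₜ h) - μ • 1) ^ j) w) := by
    intro j
    induction j with
    | zero => simp
    | succ j ih =>
      intro w
      rw [pow_succ, pow_succ, Module.End.mul_apply, Module.End.mul_apply, ← ih]
      congr 1
      simp [galoisMap_lie, galoisMap_smul]
  rw [hp, hk, map_zero]

lemma exists_tmul_of_galoisMap_eq [FiniteDimensional ℚ 𝔤] [IsGalois ℚ K] {y : K ⊗[ℚ] 𝔤}
    (hy : ∀ σ : K ≃ₐ[ℚ] K, galoisMap σ y = y) : ∃ z : 𝔤, y = 1 ⊗ₜ z := by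
  let b := Module.finBasis ℚ 𝔤
  obtain ⟨c, rfl⟩ := TensorProduct.eq_repr_basis_right b y
  have hc : ∀ i, ∃ q : ℚ, algebraMap ℚ K q = c i := by
    intro i
    refine (InfiniteGalois.mem_range_algebraMap_iff_fixed (c i)).mpr fun σ ↦ ?_
    have h := congrArg (fun v ↦ TensorProduct.equivFinsuppOfBasisRight b v i) (hy σ)
    simp only [Finsupp.sum, map_sum, galoisMap_tmul, Finsupp.coe_finsetSum, Finset.sum_apply,
      TensorProduct.equivFinsuppOfBasisRight_apply_tmul_apply, Module.Basis.repr_self] at h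
    simp only [Finsupp.single_apply, ite_smul, one_smul, zero_smul, Finset.sum_ite_eq',
      Finsupp.mem_support_iff] at h
    by_cases h0 : c i = 0
    · simp [h0]
    · simpa [h0] using h
  choose q hq using hc
  refine ⟨∑ i ∈ c.support, q i • b i, ?_⟩
  rw [Finsupp.sum, TensorProduct.tmul_sum]
  refine Finset.sum_congr rfl fun i _ ↦ ?_
  rw [← hq, TensorProduct.tmul_smul, TensorProduct.smul_tmul', Algebra.smul_def, mul_one]

/-- The normalized trace `𝕂 → ℚ` is used as the additive map. It is the identity on `ℚ`, so rational
eigenvalues survive. It is Galois-invariant, so the replica is Galois-fixed and descends to `𝔤`. Its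
values are rational, so the replica is diagonalizable over `ℚ`. -/
theorem exists_rational_replica_aux (𝕂 : Type*) [Field 𝕂] [Algebra ℚ 𝕂] [IsAlgClosed 𝕂]
    [IsGalois ℚ 𝕂] [FiniteDimensional ℚ 𝔤] [LieAlgebra.IsKilling ℚ 𝔤] (h : 𝔤) :
    ∃ h' : 𝔤, (⨆ c : ℚ, Module.End.eigenspace (LieAlgebra.ad ℚ 𝔤 h') c = ⊤) ∧
      ∀ (v : 𝔤) (k : ℚ), ⁅h, v⁆ = k • v → ⁅h', v⁆ = k • v := by
  have : CharZero 𝕂 := algebraRat.charZero 𝕂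
  let f := Algebra.normalizedTrace ℚ 𝕂
  have hfq : ∀ q : ℚ, f (algebraMap ℚ 𝕂 q) = q := fun q ↦ by
    rw [Algebra.normalizedTrace_algebraMap_apply, Algebra.normalizedTrace_self_apply]
  have hfσ : ∀ (σ : 𝕂 ≃ₐ[ℚ] 𝕂) (a : 𝕂), f (σ a) = f a := fun σ a ↦
    Algebra.normalizedTrace_map ℚ 𝕂 (σ : 𝕂 →ₐ[ℚ] 𝕂) a
  set X := LieAlgebra.ad 𝕂 (𝕂 ⊗[ℚ] 𝔤) (1 ⊗ₜ h) with hX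
  have htop := Module.End.iSup_maxGenEigenspace_eq_top X
  obtain ⟨y, hy⟩ := exists_replica (1 ⊗ₜ h : 𝕂 ⊗[ℚ] 𝔤) htop
    ((algebraMap ℚ 𝕂 : ℚ →+ 𝕂).comp (f : 𝕂 →+ ℚ))
  replace hy : ∀ μ, ∀ v ∈ X.maxGenEigenspace μ, ⁅y, v⁆ = algebraMap ℚ 𝕂 (f μ) • v := hy
  obtain ⟨h', rfl⟩ : ∃ z : 𝔤, y = 1 ⊗ₜ z := by
    refine exists_tmul_of_galoisMap_eq fun σ ↦ ?_
    -- As `ad` is injective, `σ y` and `y` need only be compared on generalized eigenspaces, which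
    -- the Galois group permutes.
    rw [← sub_eq_zero, ← LieDerivation.IsKilling.ad_apply_eq_zero_iff (R := 𝕂)]
    ext v
    suffices ⁅galoisMap σ y - y, v⁆ = 0 by simpa using this
    have hv : v ∈ ⨆ μ, X.maxGenEigenspace μ := htop ▸ Submodule.mem_top
    induction hv using Submodule.iSup_induction' with
    | zero => simp
    | add a b _ _ ha hb => rw [lie_add, ha, hb, add_zero]
    | mem μ v hv =>
      have h1 := galoisMap_mem_maxGenEigenspace σ.symm h hv
      rw [sub_lie, hy μ v hv, sub_eq_zero]
      conv_lhs => rw [← galoisMap_symm σ v]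
      rw [← galoisMap_lie, hy _ _ h1, galoisMap_smul, galoisMap_symm, hfσ, AlgEquiv.commutes]
  refine ⟨h', ?_, fun v k hv ↦ ?_⟩
  · have hfin : {μ | X.maxGenEigenspace μ ≠ ⊥}.Finite :=
      WellFoundedGT.finite_ne_bot_of_iSupIndep X.independent_maxGenEigenspace
    classical
    -- A product of distinct rational linear factors annihilates `ad h'`; this may be checked after
    -- base change.
    refine iSup_eigenspace_eq_top_of_aeval_prod _ (hfin.toFinset.image f) ?_
    have hinj : Function.Injective (Module.End.baseChangeHom ℚ 𝕂 𝔤) :=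
      LinearMap.baseChangeHom_injective ℚ 𝔤 𝕂
    apply hinj
    rw [map_zero, ← Polynomial.aeval_algHom_apply]
    have hY : Module.End.baseChangeHom ℚ 𝕂 𝔤 (LieAlgebra.ad ℚ 𝔤 h') =
      LieAlgebra.ad 𝕂 (𝕂 ⊗[ℚ] 𝔤) (1 ⊗ₜ h') :=
      (LieModule.toEnd_baseChange ..).symm
    rw [hY]
    refine LinearMap.ext fun v ↦ ?_
    have hv : v ∈ ⨆ μ, X.maxGenEigenspace μ := htop ▸ Submodule.mem_top
    induction hv using Submodule.iSup_induction' with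
    | zero => simp
    | add a b _ _ ha hb => rw [map_add, ha, hb]; simp
    | mem μ v hv =>
      by_cases hμ : X.maxGenEigenspace μ = ⊥
      · rw [hμ, Submodule.mem_bot] at hv
        simp [hv]
      · have hmem : f μ ∈ hfin.toFinset.image f :=
          Finset.mem_image_of_mem f (by simpa using hμ)
        rw [← Finset.prod_erase_mul _ _ hmem, map_mul, Module.End.mul_apply]
        have : (Polynomial.aeval (LieAlgebra.ad 𝕂 (𝕂 ⊗[ℚ] 𝔤) (1 ⊗ₜ h')))
            (Polynomial.X - Polynomial.C (f μ)) v = 0 := by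
          rw [map_sub, Polynomial.aeval_X, Polynomial.aeval_C, LinearMap.sub_apply,
            LieAlgebra.ad_apply, hy μ v hv, Module.algebraMap_end_apply, sub_eq_zero,
            algebraMap_smul]
        rw [this]; simp
  · have hmem : (1 : 𝕂) ⊗ₜ[ℚ] v ∈ X.maxGenEigenspace (algebraMap ℚ 𝕂 k) := by
      rw [Module.End.mem_maxGenEigenspace]
      refine ⟨1, ?_⟩
      rw [pow_one, LinearMap.sub_apply, hX, LieAlgebra.ad_apply,
        LieAlgebra.ExtendScalars.bracket_tmul, hv, LinearMap.smul_apply, Module.End.one_apply,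
        algebraMap_smul, TensorProduct.tmul_smul, mul_one, sub_self]
    have h1 := hy _ _ hmem
    rw [hfq, LieAlgebra.ExtendScalars.bracket_tmul, algebraMap_smul, ← TensorProduct.tmul_smul,
      mul_one] at h1
    have h2 : (1 : 𝕂) ⊗ₜ[ℚ] (⁅h', v⁆ - k • v) = 0 := by rw [TensorProduct.tmul_sub, h1, sub_self]
    have h3 : (1 : 𝕂) ⊗ₜ[ℚ] (⁅h', v⁆ - k • v) ∈ (⊥ : Submodule ℚ 𝔤).baseChange 𝕂 := by
      rw [h2]; exact Submodule.zero_mem _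
    exact sub_eq_zero.mp ((Submodule.mem_bot ℚ).mp (mem_of_tmul_mem_baseChange h3))

/-- Every element `h` has a rational replica `h'`, acting diagonalizably over `ℚ` and with the same
eigenvalue as `h` on each rational eigenvector of `h`. -/
theorem exists_rational_replica [FiniteDimensional ℚ 𝔤] [LieAlgebra.IsKilling ℚ 𝔤] (h : 𝔤) :
    ∃ h' : 𝔤, (⨆ c : ℚ, Module.End.eigenspace (LieAlgebra.ad ℚ 𝔤 h') c = ⊤) ∧
      ∀ (v : 𝔤) (k : ℚ), ⁅h, v⁆ = k • v → ⁅h', v⁆ = k • v := by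
  let : Algebra ℚ (AlgebraicClosure ℚ) := AlgebraicClosure.instAlgebra ℚ
  exact exists_rational_replica_aux (AlgebraicClosure ℚ) h

end RationalReplica

/-! ### Commuting diagonalizable families. -/

section SimultaneousEigenspaces

variable {ι K M : Type*} [Field K] [AddCommGroup M] [Module K M]

lemma maxGenEigenspace_eq_eigenspace_of_iSup_eq_top (f : Module.End K M)
    (hf : ⨆ c, f.eigenspace c = ⊤) (μ : K) : f.maxGenEigenspace μ = f.eigenspace μ := by
  have hle : ∀ ν, f.eigenspace ν ≤ f.maxGenEigenspace ν := fun ν ↦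
    (f.genEigenspace ν).mono le_top
  have h1 : f.eigenspace μ ⊔ ⨆ ν ≠ μ, f.eigenspace ν = ⊤ := by
    rw [← hf, ← iSup_split_single]
  have h2 : (⨆ ν ≠ μ, f.eigenspace ν) ⊓ f.maxGenEigenspace μ = ⊥ := by
    rw [inf_comm, eq_bot_iff, ← (f.independent_maxGenEigenspace μ).eq_bot]
    exact inf_le_inf_left _ (iSup₂_mono fun ν _ ↦ hle ν)
  rw [← top_inf_eq (f.maxGenEigenspace μ), ← h1, sup_inf_assoc_of_le _ (hle μ), h2, sup_bot_eq]

lemma iSupIndep_iInf_eigenspace (f : ι → Module.End K M) (hcomm : ∀ i j, Commute (f i) (f j)) :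
    iSupIndep fun χ : ι → K ↦ ⨅ i, (f i).eigenspace (χ i) :=
  (Module.End.independent_iInf_maxGenEigenspace_of_forall_mapsTo f fun i j φ ↦
    Module.End.mapsTo_maxGenEigenspace_of_comm (hcomm j i) φ).mono fun _ ↦
      iInf_mono fun i ↦ ((f i).genEigenspace _).mono le_top

/-- A submodule stable under a commuting family of diagonalizable endomorphisms is the sum of its
intersections with the simultaneous eigenspaces. -/
lemma eq_iSup_inf_iInf_eigenspace [FiniteDimensional K M] (f : ι → Module.End K M)
    (hcomm : ∀ i j, Commute (f i) (f j)) (hf : ∀ i, ⨆ c, (f i).eigenspace c = ⊤)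
    (p : Submodule K M) (hp : ∀ i, ∀ v ∈ p, f i v ∈ p) :
    p = ⨆ χ : ι → K, p ⊓ ⨅ i, (f i).eigenspace (χ i) := by
  have h1 := Module.End.iSup_iInf_maxGenEigenspace_eq_top_of_iSup_maxGenEigenspace_eq_top_of_commute
    (fun i ↦ (f i).restrict (hp i))
    (fun i j _ ↦ LinearMap.restrict_commute (hcomm i j) (hp i) (hp j)) (fun i ↦ by
      refine Module.End.genEigenspace_restrict_eq_top (hp i) ?_
      rw [eq_top_iff, ← hf i]
      exact iSup_mono fun c ↦ ((f i).genEigenspace _).mono le_top)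
  have h2 := congrArg (Submodule.map p.subtype) h1
  rw [Submodule.map_iSup, Submodule.map_subtype_top] at h2
  conv_lhs => rw [← h2]
  refine (iSup_congr fun χ ↦ ?_)
  rw [← Submodule.inf_iInf_maxGenEigenspace_of_forall_mapsTo f p hp]
  simp only [maxGenEigenspace_eq_eigenspace_of_iSup_eq_top _ (hf _)]

lemma isNilpotent_of_forall_exists_pow [FiniteDimensional K M] (f : Module.End K M)
    (h : ∀ v, ∃ k : ℕ, (f ^ k) v = 0) : IsNilpotent f := by
  refine ⟨Module.finrank K M, LinearMap.ext fun v ↦ ?_⟩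
  have hv : v ∈ f.maxGenEigenspace 0 := by
    rw [Module.End.mem_maxGenEigenspace]
    simpa using h v
  rw [Module.End.maxGenEigenspace_eq_genEigenspace_finrank, Module.End.mem_genEigenspace_nat] at hv
  simpa using hv

end SimultaneousEigenspaces

/-! ### Root space decomposition and Killing duality between opposite root spaces. -/

section RootSpaces

variable {𝔤 : Type*} [LieRing 𝔤] [LieAlgebra ℚ 𝔤] {T : LieSubalgebra ℚ 𝔤}

lemma mem_rootSpace {α : Module.Dual ℚ T} {x : 𝔤} :
    x ∈ rootSpace T α ↔ ∀ t : T, ⁅(t : 𝔤), x⁆ = α t • x := by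
  simp [rootSpace, Submodule.mem_iInf]

lemma lie_mem_rootSpace {α β : Module.Dual ℚ T} {x y : 𝔤} (hx : x ∈ rootSpace T α)
    (hy : y ∈ rootSpace T β) : ⁅x, y⁆ ∈ rootSpace T (α + β) := by
  rw [mem_rootSpace] at *
  intro t
  rw [leibniz_lie, hx, hy, smul_lie, lie_smul, LinearMap.add_apply, add_smul]

lemma mem_rootSpace_zero {x : 𝔤} : x ∈ rootSpace T 0 ↔ ∀ t ∈ T, ⁅t, x⁆ = 0 := by
  rw [mem_rootSpace]
  simp

lemma IsSplitTorus.le_rootSpace_zero (hT : IsSplitTorus T) : T.toSubmodule ≤ rootSpace T 0 :=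
  fun _ hx ↦ mem_rootSpace_zero.mpr fun t ht ↦ hT.1 t ht _ hx

lemma IsSplitTorus.commute_ad (hT : IsSplitTorus T) (s t : T) :
    Commute (LieAlgebra.ad ℚ 𝔤 (s : 𝔤)) (LieAlgebra.ad ℚ 𝔤 (t : 𝔤)) := by
  rw [commute_iff_lie_eq, ← LieHom.map_lie, hT.1 s s.2 t t.2, map_zero]

lemma IsSplitTorus.iSupIndep_rootSpace (hT : IsSplitTorus T) :
    iSupIndep fun α : Module.Dual ℚ T ↦ rootSpace T α :=
  (iSupIndep_iInf_eigenspace (fun t : T ↦ LieAlgebra.ad ℚ 𝔤 (t : 𝔤)) hT.commute_ad).comp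
    (f := fun α : Module.Dual ℚ T ↦ (α : T → ℚ)) DFunLike.coe_injective

variable [FiniteDimensional ℚ 𝔤]

lemma IsSplitTorus.finite_rootSpace_ne_bot (hT : IsSplitTorus T) :
    {α : Module.Dual ℚ T | rootSpace T α ≠ ⊥}.Finite :=
  WellFoundedGT.finite_ne_bot_of_iSupIndep hT.iSupIndep_rootSpace

/-- Root space decomposition of a `T`-stable subspace. -/
lemma IsSplitTorus.eq_iSup_inf_rootSpace (hT : IsSplitTorus T) (N : Submodule ℚ 𝔤)
    (hN : ∀ t ∈ T, ∀ v ∈ N, ⁅t, v⁆ ∈ N) : N = ⨆ α : Module.Dual ℚ T, N ⊓ rootSpace T α := by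
  refine le_antisymm ?_ (iSup_le fun α ↦ inf_le_left)
  conv_lhs => rw [eq_iSup_inf_iInf_eigenspace (fun t : T ↦ LieAlgebra.ad ℚ 𝔤 (t : 𝔤)) hT.commute_ad
    (fun t ↦ hT.2 t t.2) N fun t v hv ↦ hN t t.2 v hv]
  refine iSup_le fun χ ↦ ?_
  rintro v ⟨hvN, hv⟩
  by_cases hv0 : v = 0
  · rw [hv0]; exact Submodule.zero_mem _
  have hv' : ∀ t : T, ⁅(t : 𝔤), v⁆ = χ t • v := fun t ↦
    Module.End.mem_eigenspace_iff.mp ((Submodule.mem_iInf _).mp hv t)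
  -- The eigenvalue systems range over all functions on `T`; a nonzero eigenvector forces linearity.
  let α : Module.Dual ℚ T :=
    { toFun := χ
      map_add' := fun s t ↦ smul_left_injective ℚ hv0 (by
        simp only [add_smul, ← hv']
        exact add_lie _ _ _)
      map_smul' := fun c t ↦ smul_left_injective ℚ hv0 (by
        simp only [RingHom.id_apply, smul_eq_mul, mul_smul, ← hv']
        exact smul_lie _ _ _) }
  exact (le_iSup (fun α : Module.Dual ℚ T ↦ N ⊓ rootSpace T α) α) ⟨hvN, mem_rootSpace.mpr hv'⟩

lemma IsSplitTorus.iSup_rootSpace (hT : IsSplitTorus T) :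
    ⨆ α : Module.Dual ℚ T, rootSpace T α = ⊤ := by
  have := hT.eq_iSup_inf_rootSpace ⊤ fun _ _ _ _ ↦ Submodule.mem_top
  simpa using this.symm

/-- To prove that a `T`-stable subspace lies in another subspace, it suffices to look at
root vectors. -/
lemma IsSplitTorus.le_of_inf_rootSpace_le (hT : IsSplitTorus T) {N N' : Submodule ℚ 𝔤}
    (hN : ∀ t ∈ T, ∀ v ∈ N, ⁅t, v⁆ ∈ N) (h : ∀ α, ∀ v ∈ rootSpace T α, v ∈ N → v ∈ N') :
    N ≤ N' := by
  rw [hT.eq_iSup_inf_rootSpace N hN]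
  exact iSup_le fun α v hv ↦ h α v hv.2 hv.1

omit [FiniteDimensional ℚ 𝔤] in
lemma killingForm_rootSpace_eq_zero {α β : Module.Dual ℚ T}
    (hαβ : α + β ≠ 0) {x y : 𝔤} (hx : x ∈ rootSpace T α) (hy : y ∈ rootSpace T β) :
    killingForm ℚ 𝔤 x y = 0 := by
  obtain ⟨t, ht⟩ : ∃ t, (α + β) t ≠ 0 := by
    by_contra! h
    exact hαβ (LinearMap.ext h)
  rw [mem_rootSpace] at hx hy
  have h := killingForm_lie (K := ℚ) x (t : 𝔤) y
  rw [← lie_skew, hx t, hy t, map_neg, map_smul, map_smul] at h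
  simp only [LinearMap.neg_apply, LinearMap.smul_apply, smul_eq_mul, LinearMap.add_apply] at h ht
  have : (α t + β t) * killingForm ℚ 𝔤 x y = 0 := by linarith
  exact (mul_eq_zero.mp this).resolve_left ht

/-- Only the `α`-component of `z` pairs nontrivially with `𝔤_{-α}`. This lets nondegeneracy be
tested one root space at a time. -/
lemma IsSplitTorus.exists_mem_rootSpace_killingForm (hT : IsSplitTorus T) (z : 𝔤)
    (α : Module.Dual ℚ T) :
    ∃ z' ∈ rootSpace T α, ∀ v ∈ rootSpace T (-α), killingForm ℚ 𝔤 z' v = killingForm ℚ 𝔤 z v := by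
  have hz : z ∈ ⨆ β : Module.Dual ℚ T, rootSpace T β := hT.iSup_rootSpace ▸ Submodule.mem_top
  induction hz using Submodule.iSup_induction' with
  | zero => exact ⟨0, Submodule.zero_mem _, fun v _ ↦ rfl⟩
  | add a b _ _ ha hb =>
    obtain ⟨a', ha', ha⟩ := ha
    obtain ⟨b', hb', hb⟩ := hb
    refine ⟨a' + b', Submodule.add_mem _ ha' hb', fun v hv ↦ ?_⟩
    rw [map_add, map_add, LinearMap.add_apply, LinearMap.add_apply, ha v hv, hb v hv]
  | mem β z hz =>
    rcases eq_or_ne β α with rfl | hβ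
    · exact ⟨z, hz, fun _ _ ↦ rfl⟩
    · refine ⟨0, Submodule.zero_mem _, fun v hv ↦ ?_⟩
      rw [killingForm_rootSpace_eq_zero _ hz hv, map_zero, LinearMap.zero_apply]
      rwa [← sub_eq_add_neg, sub_ne_zero]

variable [LieAlgebra.IsKilling ℚ 𝔤]

omit [FiniteDimensional ℚ 𝔤] in
lemma eq_zero_of_killingForm_eq_zero {x : 𝔤} (h : ∀ y, killingForm ℚ 𝔤 x y = 0) : x = 0 := by
  have hnd := LieAlgebra.IsKilling.killingForm_nondegenerate ℚ 𝔤
  exact hnd.1 x h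

lemma exists_killingForm_eq (f : Module.Dual ℚ 𝔤) : ∃ n : 𝔤, ∀ y, killingForm ℚ 𝔤 n y = f y := by
  have hnd := LieAlgebra.IsKilling.killingForm_nondegenerate ℚ 𝔤
  obtain ⟨n, hn⟩ := ((killingForm ℚ 𝔤).toDual hnd).surjective f
  exact ⟨n, fun y ↦ by rw [← hn, LinearMap.BilinForm.toDual_def]⟩

/-- An element lies in a subspace if it is orthogonal to everything orthogonal to the subspace. -/
lemma mem_of_killingForm_eq_zero {Q : Submodule ℚ 𝔤} {x : 𝔤}
    (h : ∀ n, (∀ q ∈ Q, killingForm ℚ 𝔤 n q = 0) → killingForm ℚ 𝔤 n x = 0) : x ∈ Q := by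
  by_contra hx
  obtain ⟨f, hfx, hfQ⟩ := Submodule.exists_le_ker_of_notMem hx
  obtain ⟨n, hn⟩ := exists_killingForm_eq f
  exact hfx (by rw [← hn]; exact h n fun q hq ↦ by rw [hn]; exact hfQ hq)

lemma IsSplitTorus.eq_zero_of_mem_rootSpace (hT : IsSplitTorus T) {α : Module.Dual ℚ T} {x : 𝔤}
    (hx : x ∈ rootSpace T α) (h : ∀ y ∈ rootSpace T (-α), killingForm ℚ 𝔤 x y = 0) : x = 0 := by
  refine eq_zero_of_killingForm_eq_zero fun y ↦ ?_
  obtain ⟨y', hy', hy⟩ := hT.exists_mem_rootSpace_killingForm y (-α)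
  rw [LieModule.traceForm_comm, ← hy x (by rwa [neg_neg]), LieModule.traceForm_comm]
  exact h y' hy'

/-- Double orthogonality within the pair `𝔤_α`, `𝔤_{-α}`. Later this shows that a root vector lies
in the image of an operator or in a subalgebra. -/
lemma IsSplitTorus.mem_of_mem_rootSpace (hT : IsSplitTorus T) {Q : Submodule ℚ 𝔤}
    {α : Module.Dual ℚ T} {x : 𝔤} (hx : x ∈ rootSpace T α) (hQ : Q ≤ rootSpace T α)
    (h : ∀ n ∈ rootSpace T (-α), (∀ q ∈ Q, killingForm ℚ 𝔤 n q = 0) → killingForm ℚ 𝔤 n x = 0) :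
    x ∈ Q := by
  refine mem_of_killingForm_eq_zero fun n hn ↦ ?_
  obtain ⟨n', hn', hnn⟩ := hT.exists_mem_rootSpace_killingForm n (-α)
  rw [neg_neg] at hnn
  rw [← hnn x hx]
  exact h n' hn' fun q hq ↦ by rw [hnn q (hQ hq)]; exact hn q hq

lemma IsSplitTorus.rootSpace_neg_ne_bot (hT : IsSplitTorus T) {α : Module.Dual ℚ T}
    (h : rootSpace T α ≠ ⊥) : rootSpace T (-α) ≠ ⊥ := by
  intro h0
  refine h ((Submodule.eq_bot_iff _).mpr fun x hx ↦ hT.eq_zero_of_mem_rootSpace hx fun y hy ↦ ?_)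
  rw [h0, Submodule.mem_bot] at hy
  rw [hy, map_zero]

omit [LieAlgebra.IsKilling ℚ 𝔤] in
lemma IsSplitTorus.isNilpotent_ad (hT : IsSplitTorus T) {α : Module.Dual ℚ T} (hα : α ≠ 0) {x : 𝔤}
    (hx : x ∈ rootSpace T α) : IsNilpotent (LieAlgebra.ad ℚ 𝔤 x) := by
  refine isNilpotent_of_forall_exists_pow _ fun v ↦ ?_
  have hv : v ∈ ⨆ β : Module.Dual ℚ T, rootSpace T β := hT.iSup_rootSpace ▸ Submodule.mem_top
  induction hv using Submodule.iSup_induction' with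
  | zero => exact ⟨0, by simp⟩
  | add a b _ _ ha hb =>
    obtain ⟨k, hk⟩ := ha
    obtain ⟨l, hl⟩ := hb
    refine ⟨k + l, ?_⟩
    rw [map_add, pow_add, Module.End.mul_apply _ _ b, hl, map_zero, add_zero,
      (Commute.pow_pow_self _ _ _).eq, Module.End.mul_apply, hk, map_zero]
  | mem β v hv =>
    have hpow : ∀ k : ℕ, (LieAlgebra.ad ℚ 𝔤 x ^ k) v ∈ rootSpace T (k • α + β) := by
      intro k
      induction k with
      | zero => simpa using hv
      | succ k ih =>
        rw [pow_succ', Module.End.mul_apply, LieAlgebra.ad_apply, succ_nsmul', add_assoc]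
        exact lie_mem_rootSpace hx ih
    have hinj : Function.Injective fun k : ℕ ↦ k • α + β := fun k l hkl ↦ by
      have h1 : (k : ℚ) • α = (l : ℚ) • α := by
        rw [Nat.cast_smul_eq_nsmul, Nat.cast_smul_eq_nsmul]
        exact add_right_cancel hkl
      exact_mod_cast smul_left_injective ℚ hα h1
    obtain ⟨k, hk⟩ : ∃ k : ℕ, rootSpace T (k • α + β) = ⊥ := by
      by_contra! hne
      exact Set.infinite_of_injective_forall_mem hinj hne hT.finite_rootSpace_ne_bot
    exact ⟨k, by simpa [hk] using hpow k⟩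

end RootSpaces

/-! ### Commutator identities in associative algebras. -/

section NilpotentIdentities

variable {A : Type*} [Ring A] [Algebra ℚ A]

/-- If `f` is nilpotent and commutes with `c = f g - g f`, then `c` is nilpotent. -/
lemma isNilpotent_commutator {f g c : A} (hc : f * g - g * f = c) (hfc : f * c = c * f)
    (hf : IsNilpotent f) : IsNilpotent c := by
  have hpow : ∀ k : ℕ, f ^ (k + 1) * g - g * f ^ (k + 1) = ((k : ℚ) + 1) • (f ^ k * c) := by
    intro k
    induction k with
    | zero => simpa using hc
    | succ k ih =>
      have h1 : f ^ (k + 1 + 1) * g - g * f ^ (k + 1 + 1) =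
          f * (f ^ (k + 1) * g - g * f ^ (k + 1)) + (f * g - g * f) * f ^ (k + 1) := by
        rw [pow_succ' f (k + 1)]; noncomm_ring
      have h2 : c * f ^ (k + 1) = f ^ (k + 1) * c :=
        ((show Commute f c from hfc).pow_left (k + 1)).eq.symm
      rw [h1, ih, hc, h2, mul_smul_comm, ← mul_assoc, ← pow_succ']
      push_cast
      module
  have hcf : ∀ a k : ℕ, c ^ a * f ^ k = f ^ k * c ^ a := fun a k ↦
    ((show Commute f c from hfc).pow_pow k a).eq.symm
  -- Powers of `f` are traded for powers of `c`: bracketing `f ^ (k + 1)` with `g` between two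
  -- factors `c ^ a` turns `f ^ (k + 1) * c ^ a = 0` into `f ^ k * c ^ (2 * a + 1) = 0`.
  have key : ∀ k a : ℕ, f ^ k * c ^ a = 0 → IsNilpotent c := by
    intro k
    induction k with
    | zero => exact fun a ha ↦ ⟨a, by simpa using ha⟩
    | succ k ih =>
      intro a ha
      refine ih (a + (1 + a)) ?_
      have h1 : c ^ a * (f ^ (k + 1) * g - g * f ^ (k + 1)) * c ^ a = 0 := by
        have h2 : c ^ a * (f ^ (k + 1) * g - g * f ^ (k + 1)) * c ^ a =
            (c ^ a * f ^ (k + 1)) * g * c ^ a - c ^ a * g * (f ^ (k + 1) * c ^ a) := by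
          noncomm_ring
        rw [h2, hcf, ha]; simp
      rw [hpow, mul_smul_comm, smul_mul_assoc, ← mul_assoc, hcf, mul_assoc, mul_assoc] at h1
      have h3 := (smul_eq_zero.mp h1).resolve_left (by positivity)
      rw [pow_add, pow_add, pow_one]
      exact h3
  obtain ⟨m, hm⟩ := hf
  exact key m 0 (by simp [hm])

/-- No relation between `H` and `Y` enters, so half of an `sl₂`-triple is enough. -/
lemma sl2_commutator_pow {X Y H : A} (hXY : X * Y - Y * X = H) (hHX : H * X - X * H = (2 : ℚ) • X)
    (j : ℕ) : X ^ (j + 1) * Y - Y * X ^ (j + 1) =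
      ((j : ℚ) + 1) • (H * X ^ j - (j : ℚ) • X ^ j) := by
  induction j with
  | zero => simpa using hXY
  | succ j ih =>
    have h1 : X ^ (j + 1 + 1) * Y - Y * X ^ (j + 1 + 1) =
        X * (X ^ (j + 1) * Y - Y * X ^ (j + 1)) + (X * Y - Y * X) * X ^ (j + 1) := by
      rw [pow_succ' X (j + 1)]; noncomm_ring
    have h2 : X * (H * X ^ j) = H * X ^ (j + 1) - (2 : ℚ) • X ^ (j + 1) := by
      rw [pow_succ', ← mul_assoc, ← smul_mul_assoc, ← mul_assoc, ← sub_mul, ← hHX, sub_sub_cancel]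
    rw [h1, ih, hXY, mul_smul_comm, mul_sub, mul_smul_comm, h2, ← pow_succ']
    push_cast
    module

end NilpotentIdentities

/-! ### The centralizer of a maximal split torus, and coroots. -/

section MaximalTorus

variable {𝔤 : Type*} [LieRing 𝔤] [LieAlgebra ℚ 𝔤] {T : LieSubalgebra ℚ 𝔤} [FiniteDimensional ℚ 𝔤]

/-- A diagonalizable element centralizing a maximal split torus belongs to it. -/
lemma IsMaximalSplitTorus.mem_of_diagonalizable (hT : IsMaximalSplitTorus T) {h : 𝔤}
    (hd : ⨆ c : ℚ, Module.End.eigenspace (LieAlgebra.ad ℚ 𝔤 h) c = ⊤)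
    (hc : ∀ t ∈ T, ⁅h, t⁆ = 0) : h ∈ T := by
  have habel : ∀ s ∈ T, ∀ t ∈ T, ∀ a b : ℚ, ⁅s + a • h, t + b • h⁆ = 0 := by
    intro s hs t ht a b
    simp [hT.1.1 s hs t ht, hc t ht, ← lie_skew s h, hc s hs]
  have hmem : ∀ u, u ∈ T.toSubmodule ⊔ ℚ ∙ h ↔ ∃ s ∈ T, ∃ a : ℚ, s + a • h = u := by
    intro u
    simp only [Submodule.mem_sup, Submodule.mem_span_singleton, exists_exists_eq_and]
    rfl
  let T' : LieSubalgebra ℚ 𝔤 :=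
    { toSubmodule := T.toSubmodule ⊔ ℚ ∙ h
      lie_mem' := by
        intro u v hu hv
        obtain ⟨s, hs, a, rfl⟩ := (hmem _).mp hu
        obtain ⟨t, ht, b, rfl⟩ := (hmem _).mp hv
        rw [habel s hs t ht]
        exact Submodule.zero_mem _ }
  have hT' : IsSplitTorus T' := by
    refine ⟨fun u hu v hv ↦ ?_, fun u hu ↦ ?_⟩
    · obtain ⟨s, hs, a, rfl⟩ := (hmem _).mp hu
      obtain ⟨t, ht, b, rfl⟩ := (hmem _).mp hv
      exact habel s hs t ht a b
    · obtain ⟨s, hs, a, rfl⟩ := (hmem _).mp hu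
      rw [map_add, map_smul]
      refine iSup_eigenspace_add_eq_top ?_ (hT.1.2 s hs) (iSup_eigenspace_smul_eq_top hd a)
      refine Commute.smul_right ?_ a
      rw [commute_iff_lie_eq, ← LieHom.map_lie, ← lie_skew, hc s hs, neg_zero, map_zero]
  exact hT.2 hT' (fun s hs ↦ (hmem s).mpr ⟨s, hs, 0, by simp⟩)
    ((hmem h).mpr ⟨0, T.zero_mem, 1, by simp⟩)

variable [LieAlgebra.IsKilling ℚ 𝔤]

/-- Elements of `T` are eigenvectors of `h` for the eigenvalue `0`, so the rational replica of `h`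
also centralizes `T`; maximality puts it in `T`. -/
lemma IsMaximalSplitTorus.exists_replica (hT : IsMaximalSplitTorus T) {h : 𝔤}
    (hh : h ∈ rootSpace T 0) :
    ∃ t : T, ∀ (v : 𝔤) (k : ℚ), ⁅h, v⁆ = k • v → ⁅(t : 𝔤), v⁆ = k • v := by
  obtain ⟨h', hd, hv⟩ := exists_rational_replica h
  refine ⟨⟨h', hT.mem_of_diagonalizable hd fun t ht ↦ ?_⟩, hv⟩
  have h0 : ⁅h, t⁆ = (0 : ℚ) • t := by
    rw [← lie_skew, mem_rootSpace_zero.mp hh t ht, neg_zero, zero_smul]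
  rw [hv t 0 h0, zero_smul]

/-- The centralizer of a maximal split torus contains no nonzero nilpotent elements. -/
lemma IsMaximalSplitTorus.eq_zero_of_isNilpotent (hT : IsMaximalSplitTorus T) {x : 𝔤}
    (hx : x ∈ rootSpace T 0) (hnil : IsNilpotent (LieAlgebra.ad ℚ 𝔤 x)) : x = 0 := by
  have hle : (rootSpace T 0).map (LieAlgebra.ad ℚ 𝔤 x) ≤ rootSpace T 0 := by
    rintro _ ⟨y, hy, rfl⟩
    simpa using lie_mem_rootSpace hx hy
  -- An `n ∈ 𝔤_0` orthogonal to `[x, 𝔤_0]` commutes with `x`, so `ad n ∘ ad x` is nilpotent and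
  -- `κ(n, x) = 0`.
  have hmem : x ∈ (rootSpace T 0).map (LieAlgebra.ad ℚ 𝔤 x) := by
    refine hT.1.mem_of_mem_rootSpace hx hle fun n hn hnq ↦ ?_
    rw [neg_zero] at hn
    have hnx : ⁅n, x⁆ = 0 := by
      refine hT.1.eq_zero_of_mem_rootSpace (α := 0) (by simpa using lie_mem_rootSpace hn hx)
        fun y hy ↦ ?_
      rw [neg_zero] at hy
      rw [killingForm_lie]
      exact hnq _ ⟨y, hy, rfl⟩
    have hcomm : Commute (LieAlgebra.ad ℚ 𝔤 n) (LieAlgebra.ad ℚ 𝔤 x) := by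
      rw [commute_iff_lie_eq, ← LieHom.map_lie, hnx, map_zero]
    exact (LinearMap.isNilpotent_trace_of_isNilpotent (hcomm.isNilpotent_mul_left hnil)).eq_zero
  obtain ⟨z, hz, hzx⟩ := hmem
  -- Since `[x, z] = x`, the element `-z` has eigenvalue `1` on `x`, and so does its replica in `T`;
  -- but `T` kills `x`.
  obtain ⟨t, ht⟩ := hT.exists_replica (Submodule.neg_mem _ hz)
  have h1 := ht x 1 (by rw [neg_lie, lie_skew, one_smul]; exact hzx)
  rw [mem_rootSpace_zero.mp hx t t.2, one_smul] at h1
  exact h1.symm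

/-- Half of Jacobson–Morozov, by duality. If `n ∈ 𝔤_{-α}` is orthogonal to `(ad x)² 𝔤_{-α}`, then
`[x, n]` commutes with `x`, so it is nilpotent in `𝔤_0` and hence zero. Then `α(t) κ(x, n) = κ(t,
[x, n]) = 0` for all `t`. -/
lemma IsMaximalSplitTorus.exists_lie_lie_eq (hT : IsMaximalSplitTorus T) {α : Module.Dual ℚ T}
    (hα : α ≠ 0) {x : 𝔤} (hx : x ∈ rootSpace T α) : ∃ y ∈ rootSpace T (-α), ⁅x, ⁅x, y⁆⁆ = x := by
  let X := LieAlgebra.ad ℚ 𝔤 x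
  have hle : (rootSpace T (-α)).map (X * X) ≤ rootSpace T α := by
    rintro _ ⟨y, hy, rfl⟩
    have := lie_mem_rootSpace hx (lie_mem_rootSpace hx hy)
    rwa [add_neg_cancel, add_zero] at this
  suffices hmem : x ∈ (rootSpace T (-α)).map (X * X) by
    obtain ⟨y, hy, hyx⟩ := hmem
    exact ⟨y, hy, hyx⟩
  refine hT.1.mem_of_mem_rootSpace hx hle fun n hn hnq ↦ ?_
  have hnx0 : ⁅n, x⁆ ∈ rootSpace T 0 := by simpa using lie_mem_rootSpace hn hx
  have hnxx : ⁅⁅n, x⁆, x⁆ = 0 := by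
    refine hT.1.eq_zero_of_mem_rootSpace (α := α) ?_ fun y hy ↦ ?_
    · have := lie_mem_rootSpace hnx0 hx
      rwa [zero_add] at this
    rw [killingForm_lie, killingForm_lie]
    exact hnq _ ⟨y, hy, rfl⟩
  have hnil : IsNilpotent (LieAlgebra.ad ℚ 𝔤 ⁅x, n⁆) := by
    refine isNilpotent_commutator (f := X) (g := LieAlgebra.ad ℚ 𝔤 n) ?_ ?_
      (hT.1.isNilpotent_ad hα hx)
    · rw [LieHom.map_lie]; rfl
    · have : ⁅X, LieAlgebra.ad ℚ 𝔤 ⁅x, n⁆⁆ = 0 := by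
        rw [← LieHom.map_lie, ← lie_skew x n, lie_neg, lie_skew, hnxx, map_zero]
      exact (commute_iff_lie_eq.mpr this).eq
  have hxn : ⁅x, n⁆ = 0 := hT.eq_zero_of_isNilpotent
    (by rw [← lie_skew]; exact Submodule.neg_mem _ hnx0) hnil
  obtain ⟨t, ht⟩ : ∃ t, α t ≠ 0 := by
    by_contra! h
    exact hα (LinearMap.ext h)
  have h1 := killingForm_lie (K := ℚ) (t : 𝔤) x n
  rw [hxn, map_zero, mem_rootSpace.mp hx t, map_smul, LinearMap.smul_apply, smul_eq_mul] at h1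
  rw [LieModule.traceForm_comm]
  exact (mul_eq_zero.mp h1).resolve_left ht

/-- A coroot-like element of the torus attached to a nonzero root vector `x`: the operator `ad x` is
injective on root spaces on which it is negative. -/
theorem IsMaximalSplitTorus.exists_coroot (hT : IsMaximalSplitTorus T) {α : Module.Dual ℚ T}
    (hα : α ≠ 0) {x : 𝔤} (hx : x ∈ rootSpace T α) (hx0 : x ≠ 0) :
    ∃ t : T, α t = 2 ∧
      ∀ β : Module.Dual ℚ T, β t < 0 → ∀ z ∈ rootSpace T β, ⁅x, z⁆ = 0 → z = 0 := by
  obtain ⟨y, hy, hyx⟩ := hT.exists_lie_lie_eq hα hx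
  let X := LieAlgebra.ad ℚ 𝔤 x
  let Y := LieAlgebra.ad ℚ 𝔤 ((-2 : ℚ) • y)
  -- The factor `-2` turns `[x, [x, y]] = x` into `[h, x] = 2x`. Only the replica `t` of `h` is
  -- known to lie in `T`.
  obtain ⟨h, hh⟩ : ∃ h, h = ⁅x, (-2 : ℚ) • y⁆ := ⟨_, rfl⟩
  have hh0 : h ∈ rootSpace T 0 := by
    have := lie_mem_rootSpace hx (Submodule.smul_mem _ (-2 : ℚ) hy)
    rwa [add_neg_cancel, ← hh] at this
  have hhx : ⁅h, x⁆ = (2 : ℚ) • x := by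
    rw [hh, lie_smul, smul_lie, ← lie_skew, hyx, smul_neg, neg_smul, neg_neg]
  have hXY : X * Y - Y * X = LieAlgebra.ad ℚ 𝔤 h := by rw [hh, LieHom.map_lie]; rfl
  have hHX : LieAlgebra.ad ℚ 𝔤 h * X - X * LieAlgebra.ad ℚ 𝔤 h = (2 : ℚ) • X := by
    rw [← map_smul, ← hhx, LieHom.map_lie]; rfl
  obtain ⟨t, ht⟩ := hT.exists_replica hh0
  refine ⟨t, ?_, fun β hβ z hz hxz ↦ ?_⟩
  · have h1 := ht x 2 hhx
    rw [mem_rootSpace.mp hx t] at h1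
    exact smul_left_injective ℚ hx0 h1
  by_contra hz0
  obtain ⟨N, hN⟩ := hT.1.isNilpotent_ad hα hx
  -- Choose `j` with `p j` but not `p (j + 1)`. By the `sl₂` identity `(h - j) v` is in the image of
  -- `X ^ (j + 1)`, so it vanishes. Thus `h`, and with it `t`, has eigenvalue `j ≥ 0` on `v`,
  -- although `β t < 0`.
  let p : ℕ → Prop := fun j ↦ ∃ v, v ≠ 0 ∧ v ∈ rootSpace T β ∧ ⁅x, v⁆ = 0 ∧ ∃ u, (X ^ j) u = v
  have hp0 : p 0 := ⟨z, hz0, hz, hxz, z, rfl⟩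
  have hpN : ¬ p N := by
    rintro ⟨v, hv0, -, -, u, hu⟩
    refine hv0 ?_
    rw [← hu, show X ^ N = 0 from hN, LinearMap.zero_apply]
  obtain ⟨j, hj, hj1⟩ : ∃ j, p j ∧ ¬ p (j + 1) := by
    by_contra! hcon
    exact hpN (Nat.rec hp0 (fun j hj ↦ hcon j hj) N)
  obtain ⟨v, hv0, hvβ, hxv, u, hu⟩ := hj
  have hXu : (X ^ (j + 1)) u = 0 := by
    rw [pow_succ', Module.End.mul_apply, hu]; exact hxv
  have hid := congrArg (fun f : Module.End ℚ 𝔤 ↦ f u) (sl2_commutator_pow hXY hHX j)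
  simp only [LinearMap.sub_apply, Module.End.mul_apply, LinearMap.smul_apply, hXu, hu, map_zero,
    sub_zero, LieAlgebra.ad_apply] at hid
  have hhv : ⁅h, v⁆ = (j : ℚ) • v := by
    rw [← sub_eq_zero]
    by_contra hne
    refine hj1 ⟨_, hne, ?_, ?_, ((j : ℚ) + 1)⁻¹ • Y u, ?_⟩
    · refine Submodule.sub_mem _ ?_ (Submodule.smul_mem _ _ hvβ)
      simpa using lie_mem_rootSpace hh0 hvβ
    · rw [lie_sub, lie_smul, hxv, smul_zero, sub_zero, leibniz_lie, hxv, lie_zero, add_zero,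
        ← lie_skew x h, hhx, neg_lie, smul_lie, hxv, smul_zero, neg_zero]
    · rw [map_smul, hid, smul_smul, inv_mul_cancel₀ (by positivity), one_smul]
  have h1 := ht v j hhv
  rw [mem_rootSpace.mp hvβ t] at h1
  have h2 : β t = j := smul_left_injective ℚ hv0 h1
  rw [h2] at hβ
  exact absurd hβ (not_lt.mpr (Nat.cast_nonneg j))

end MaximalTorus

/-! ### Parabolic and minimal parabolic subalgebras via their Killing-orthogonals. -/

section Parabolic

variable {𝔤 : Type*} [LieRing 𝔤] [LieAlgebra ℚ 𝔤]

/-- The orthogonal of a subspace for the Killing form. -/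
def killingPerp (Q : Submodule ℚ 𝔤) : Submodule ℚ 𝔤 where
  carrier := {n | ∀ q ∈ Q, killingForm ℚ 𝔤 n q = 0}
  add_mem' := fun {u v} hu hv q hq ↦ by
    rw [map_add, LinearMap.add_apply, hu q hq, hv q hq, add_zero]
  zero_mem' := fun q _ ↦ by simp
  smul_mem' := fun c u hu q hq ↦ by rw [map_smul, LinearMap.smul_apply, hu q hq, smul_zero]

lemma mem_killingPerp {Q : Submodule ℚ 𝔤} {n : 𝔤} :
    n ∈ killingPerp Q ↔ ∀ q ∈ Q, killingForm ℚ 𝔤 n q = 0 := Iff.rfl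

lemma lie_mem_killingPerp {Q : Submodule ℚ 𝔤} {x n : 𝔤} (hx : ∀ q ∈ Q, ⁅x, q⁆ ∈ Q)
    (hn : n ∈ killingPerp Q) : ⁅x, n⁆ ∈ killingPerp Q := by
  intro q hq
  rw [← lie_skew, map_neg, LinearMap.neg_apply, killingForm_lie, hn _ (hx q hq), neg_zero]

variable [FiniteDimensional ℚ 𝔤] [LieAlgebra.IsKilling ℚ 𝔤]

/-- The Killing-orthogonal of a parabolic subalgebra is contained in it and consists of
`ad`-nilpotent elements. -/
theorem IsParabolic.mem_and_isNilpotent {P : LieSubalgebra ℚ 𝔤} (hP : IsParabolic P) {x : 𝔤}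
    (hx : x ∈ killingPerp P.toSubmodule) : x ∈ P ∧ IsNilpotent (LieAlgebra.ad ℚ 𝔤 x) := by
  obtain ⟨B, hB, hBP⟩ := hP
  have hxB : ∀ b ∈ B, killingForm ℂ (ℂ ⊗[ℚ] 𝔤) (1 ⊗ₜ x) b = 0 := by
    have hle : P.toSubmodule.baseChange ℂ ≤ LinearMap.ker (killingForm ℂ (ℂ ⊗[ℚ] 𝔤) (1 ⊗ₜ x)) := by
      rw [Submodule.baseChange_eq_span, Submodule.span_le]
      rintro _ ⟨p, hp, rfl⟩
      simp only [SetLike.mem_coe, LinearMap.mem_ker, TensorProduct.mk_apply]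
      rw [killingForm_tmul, hx p hp, map_zero, mul_zero]
    exact fun b hb ↦ hle (hBP hb)
  exact ⟨mem_of_tmul_mem_baseChange (hBP (hB.mem_of_orthogonal hxB)),
    isNilpotent_of_isNilpotent_ad_tmul (hB.isNilpotent_ad_of_orthogonal hxB)⟩

/-- A subalgebra is parabolic if it contains its Killing-orthogonal and the latter is spanned by
`ad`-nilpotent elements. -/
theorem isParabolic_of_killingPerp_le {Q : LieSubalgebra ℚ 𝔤}
    (hQ : killingPerp Q.toSubmodule ≤ Q.toSubmodule)
    (hnil : killingPerp Q.toSubmodule ≤ Submodule.span ℚ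
      {n | n ∈ killingPerp Q.toSubmodule ∧ IsNilpotent (LieAlgebra.ad ℚ 𝔤 n)}) :
    IsParabolic Q := by
  set N := killingPerp Q.toSubmodule
  have hlie : ∀ u ∈ N.baseChange ℂ, ∀ v ∈ N.baseChange ℂ, ⁅u, v⁆ ∈ N.baseChange ℂ := by
    intro u hu v hv
    rw [Submodule.baseChange_eq_span] at hu hv
    induction hu, hv using Submodule.span_induction₂ with
    | mem_mem u v hu hv =>
      obtain ⟨a, ha, rfl⟩ := hu
      obtain ⟨b, hb, rfl⟩ := hv
      simp only [TensorProduct.mk_apply, LieAlgebra.ExtendScalars.bracket_tmul]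
      exact Submodule.tmul_mem_baseChange_of_mem _
        (lie_mem_killingPerp (fun q hq ↦ Q.lie_mem (hQ ha) hq) hb)
    | zero_left v hv => rw [zero_lie]; exact Submodule.zero_mem _
    | zero_right u hu => rw [lie_zero]; exact Submodule.zero_mem _
    | add_left u u' v _ _ _ h h' => rw [add_lie]; exact Submodule.add_mem _ h h'
    | add_right u v v' _ _ _ h h' => rw [lie_add]; exact Submodule.add_mem _ h h'
    | smul_left c u v _ _ h => rw [smul_lie]; exact Submodule.smul_mem _ _ h
    | smul_right c u v _ _ h => rw [lie_smul]; exact Submodule.smul_mem _ _ h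
  have horth : ∀ u ∈ N.baseChange ℂ, ∀ v ∈ N.baseChange ℂ,
      killingForm ℂ (ℂ ⊗[ℚ] 𝔤) u v = 0 := by
    intro u hu v hv
    rw [Submodule.baseChange_eq_span] at hu hv
    induction hu, hv using Submodule.span_induction₂ with
    | mem_mem u v hu hv =>
      obtain ⟨a, ha, rfl⟩ := hu
      obtain ⟨b, hb, rfl⟩ := hv
      simp only [TensorProduct.mk_apply]
      rw [killingForm_tmul, mem_killingPerp.mp ha b (hQ hb), map_zero, mul_zero]
    | zero_left v hv => simp
    | zero_right u hu => simp
    | add_left u u' v _ _ _ h h' => rw [map_add, LinearMap.add_apply, h, h', add_zero]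
    | add_right u v v' _ _ _ h h' => rw [map_add, h, h', add_zero]
    | smul_left c u v _ _ h => rw [map_smul, LinearMap.smul_apply, h, smul_zero]
    | smul_right c u v _ _ h => rw [map_smul, h, smul_zero]
  let NC : LieSubalgebra ℂ (ℂ ⊗[ℚ] 𝔤) :=
    { toSubmodule := N.baseChange ℂ
      lie_mem' := fun {u v} hu hv ↦ hlie u hu v hv }
  have hsolv : LieAlgebra.IsSolvable NC := isSolvable_of_killingForm_eq_zero NC
    fun u hu v hv w hw ↦ horth u hu _ (hlie v hv w hw)
  -- Nilpotent elements of a solvable `B` are orthogonal to `B`. So `B` is orthogonal to a spanning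
  -- set of `N`, hence contained in the base change of `Q`.
  obtain ⟨B, hB, hNB⟩ := exists_isBorel_ge NC hsolv
  refine ⟨B, hB, fun b hb ↦ mem_baseChange_of_orthogonal fun n hn ↦ ?_⟩
  have : LieAlgebra.IsSolvable B := hB.1
  have hker : ∀ m ∈ Submodule.span ℚ {n | n ∈ N ∧ IsNilpotent (LieAlgebra.ad ℚ 𝔤 n)},
      killingForm ℂ (ℂ ⊗[ℚ] 𝔤) (1 ⊗ₜ m) b = 0 := by
    intro m hm
    induction hm using Submodule.span_induction with
    | mem n h =>
      exact killingForm_eq_zero_of_isNilpotent B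
        (hNB (Submodule.tmul_mem_baseChange_of_mem 1 h.1)) hb (isNilpotent_ad_tmul h.2)
    | zero => simp
    | add m n _ _ hm hn =>
      rw [TensorProduct.tmul_add, map_add, LinearMap.add_apply, hm, hn, add_zero]
    | smul c n _ hn =>
      rw [TensorProduct.tmul_smul, ← algebraMap_smul ℂ c, map_smul, LinearMap.smul_apply, hn,
        smul_zero]
  exact hker n (hnil hn)

variable {T P : LieSubalgebra ℚ 𝔤}

/-- A parabolic subalgebra containing a maximal split torus contains its centralizer. -/
theorem IsParabolic.rootSpace_zero_le (hT : IsMaximalSplitTorus T) (hP : IsParabolic P)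
    (hTP : T ≤ P) : rootSpace T 0 ≤ P.toSubmodule := by
  intro x hx
  refine mem_of_killingForm_eq_zero fun n hn ↦ ?_
  -- The orthogonal of `P` is graded; its weight-zero part consists of nilpotent elements of `𝔤_0`,
  -- so it is zero.
  suffices hle : killingPerp P.toSubmodule ≤ killingPerp (rootSpace T 0) from hle hn x hx
  refine hT.1.le_of_inf_rootSpace_le
    (fun t ht v hv ↦ lie_mem_killingPerp (fun q hq ↦ P.lie_mem (hTP ht) hq) hv) fun α v hv hvP ↦ ?_
  rcases eq_or_ne α 0 with rfl | hα
  · rw [hT.eq_zero_of_isNilpotent hv (hP.mem_and_isNilpotent hvP).2]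
    exact Submodule.zero_mem _
  · exact fun q hq ↦ killingForm_rootSpace_eq_zero (by rwa [add_zero]) hv hq

/-- A subalgebra containing the centralizer of a maximal split torus and its own
Killing-orthogonal is parabolic. -/
theorem isParabolic_of_rootSpace_zero_le (hT : IsSplitTorus T) {Q : LieSubalgebra ℚ 𝔤}
    (h0 : rootSpace T 0 ≤ Q.toSubmodule)
    (hQ : ∀ α ≠ 0, ∀ v ∈ rootSpace T α, v ∈ killingPerp Q.toSubmodule → v ∈ Q) :
    IsParabolic Q := by
  have hTQ : T.toSubmodule ≤ Q.toSubmodule := hT.le_rootSpace_zero.trans h0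
  have hst : ∀ t ∈ T, ∀ v ∈ killingPerp Q.toSubmodule, ⁅t, v⁆ ∈ killingPerp Q.toSubmodule :=
    fun t ht v hv ↦ lie_mem_killingPerp (fun q hq ↦ Q.lie_mem (hTQ ht) hq) hv
  have hzero : ∀ v ∈ rootSpace T 0, v ∈ killingPerp Q.toSubmodule → v = 0 := fun v hv hvQ ↦
    hT.eq_zero_of_mem_rootSpace hv fun y hy ↦ hvQ y (h0 (by rwa [neg_zero] at hy))
  refine isParabolic_of_killingPerp_le (hT.le_of_inf_rootSpace_le hst fun α v hv hvQ ↦ ?_)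
    (hT.le_of_inf_rootSpace_le hst fun α v hv hvQ ↦ ?_)
  all_goals rcases eq_or_ne α 0 with rfl | hα
  · rw [hzero v hv hvQ]; exact Submodule.zero_mem _
  · exact hQ α hα v hv hvQ
  · rw [hzero v hv hvQ]; exact Submodule.zero_mem _
  · exact Submodule.subset_span ⟨hvQ, hT.isNilpotent_ad hα hv⟩

/-- The span of the root spaces on which `t` is non-negative. -/
def nonnegSpan (t : T) : Submodule ℚ 𝔤 :=
  ⨆ α : {α : Module.Dual ℚ T // 0 ≤ α t}, rootSpace T α

omit [FiniteDimensional ℚ 𝔤] [LieAlgebra.IsKilling ℚ 𝔤] in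
lemma rootSpace_le_nonnegSpan {t : T} {α : Module.Dual ℚ T} (h : 0 ≤ α t) :
    rootSpace T α ≤ nonnegSpan t :=
  le_iSup (fun α : {α : Module.Dual ℚ T // 0 ≤ α t} ↦ rootSpace T (α : Module.Dual ℚ T)) ⟨α, h⟩

omit [FiniteDimensional ℚ 𝔤] [LieAlgebra.IsKilling ℚ 𝔤] in
lemma lie_mem_nonnegSpan {t : T} {u v : 𝔤} (hu : u ∈ nonnegSpan t) (hv : v ∈ nonnegSpan t) :
    ⁅u, v⁆ ∈ nonnegSpan t := by
  induction hu using Submodule.iSup_induction' with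
  | zero => rw [zero_lie]; exact Submodule.zero_mem _
  | add a b _ _ ha hb => rw [add_lie]; exact Submodule.add_mem _ ha hb
  | mem α u hu =>
    induction hv using Submodule.iSup_induction' with
    | zero => rw [lie_zero]; exact Submodule.zero_mem _
    | add a b _ _ ha hb => rw [lie_add]; exact Submodule.add_mem _ ha hb
    | mem β v hv => exact rootSpace_le_nonnegSpan (add_nonneg α.2 β.2) (lie_mem_rootSpace hu hv)

/-- In a minimal parabolic subalgebra, opposite root vectors are Killing-orthogonal. -/
theorem IsMinimalParabolic.killingForm_eq_zero (hT : IsMaximalSplitTorus T)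
    (hP : IsMinimalParabolic P) (hTP : T ≤ P) {α : Module.Dual ℚ T} (hα : α ≠ 0) {p q : 𝔤}
    (hp : p ∈ P) (hpα : p ∈ rootSpace T α) (hq : q ∈ P) (hqα : q ∈ rootSpace T (-α)) :
    killingForm ℚ 𝔤 p q = 0 := by
  obtain ⟨t, ht⟩ : ∃ t, α t < 0 := by
    obtain ⟨t, ht⟩ : ∃ t, α t ≠ 0 := by
      by_contra! h
      exact hα (LinearMap.ext h)
    rcases lt_or_gt_of_ne ht with h | h
    · exact ⟨t, h⟩
    · exact ⟨-t, by rw [map_neg]; linarith⟩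
  have h0 := hP.1.rootSpace_zero_le hT hTP
  have hR : killingPerp P.toSubmodule ≤ P.toSubmodule := fun x hx ↦ (hP.1.mem_and_isNilpotent hx).1
  have hPR : ∀ x ∈ P, ∀ n ∈ killingPerp P.toSubmodule, ⁅x, n⁆ ∈ killingPerp P.toSubmodule :=
    fun x hx n hn ↦ lie_mem_killingPerp (fun q hq ↦ P.lie_mem hx hq) hn
  -- This smaller subalgebra is again parabolic, so it equals `P` by minimality. As `α t < 0`,
  -- neither of its summands pairs with `q`.
  let Q : LieSubalgebra ℚ 𝔤 :=
    { toSubmodule := (P.toSubmodule ⊓ nonnegSpan t) ⊔ killingPerp P.toSubmodule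
      lie_mem' := by
        intro u v hu hv
        obtain ⟨a, ha, r, hr, rfl⟩ := Submodule.mem_sup.mp hu
        obtain ⟨b, hb, s, hs, rfl⟩ := Submodule.mem_sup.mp hv
        refine Submodule.mem_sup.mpr ⟨⁅a, b⁆, ⟨P.lie_mem ha.1 hb.1, lie_mem_nonnegSpan ha.2 hb.2⟩,
          ⁅a + r, s⁆ - ⁅b, r⁆, Submodule.sub_mem _ (hPR _ (P.add_mem ha.1 (hR hr)) s hs)
            (hPR b hb.1 r hr), ?_⟩
        rw [add_lie a r s, lie_add, add_lie, add_lie, ← lie_skew b r]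
        abel }
  have hPQ : (P.toSubmodule ⊓ nonnegSpan t) ≤ Q.toSubmodule := le_sup_left
  have hRQ : killingPerp P.toSubmodule ≤ Q.toSubmodule := le_sup_right
  have hQP : Q ≤ P := show Q.toSubmodule ≤ P.toSubmodule from sup_le inf_le_left hR
  have hQ : IsParabolic Q := by
    refine isParabolic_of_rootSpace_zero_le hT.1
      (fun x hx ↦ hPQ ⟨h0 hx, rootSpace_le_nonnegSpan (by simp) hx⟩) fun β _ v hv hvQ ↦ ?_
    have hvP : v ∈ P.toSubmodule := mem_of_killingForm_eq_zero fun n hn ↦ by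
      rw [LieModule.traceForm_comm]
      exact hvQ n (hRQ hn)
    rcases le_or_gt 0 (β t) with hβ | hβ
    · exact hPQ ⟨hvP, rootSpace_le_nonnegSpan hβ hv⟩
    · refine hRQ ?_
      -- Only vectors of `P` of weight `-β` could pair with `v`; since `β t < 0` they lie in
      -- `nonnegSpan t`, hence in `Q`, to which `v` is orthogonal.
      have hle : P.toSubmodule ≤ killingPerp (ℚ ∙ v) := by
        refine hT.1.le_of_inf_rootSpace_le (fun s hs v hv ↦ P.lie_mem (hTP hs) hv)
          fun γ w hw hwP ↦ ?_
        intro u hu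
        obtain ⟨c, rfl⟩ := Submodule.mem_span_singleton.mp hu
        rw [map_smul, LieModule.traceForm_comm]
        by_cases hβγ : β + γ = 0
        · rw [hvQ w (hPQ ⟨hwP, rootSpace_le_nonnegSpan ?_ hw⟩), smul_zero]
          rw [eq_neg_of_add_eq_zero_right hβγ, LinearMap.neg_apply]
          linarith
        · rw [killingForm_rootSpace_eq_zero hβγ hv hw, smul_zero]
      intro w hw
      rw [LieModule.traceForm_comm]
      exact hle hw v (Submodule.mem_span_singleton_self v)
  have hpQ : p ∈ Q.toSubmodule := hP.2 hQ hQP hp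
  obtain ⟨a, ha, r, hr, rfl⟩ := Submodule.mem_sup.mp hpQ
  rw [map_add, LinearMap.add_apply, hr q hq, add_zero]
  have ha' : a ∈ nonnegSpan t := ha.2
  clear hpQ ha hp hpα
  induction ha' using Submodule.iSup_induction' with
  | zero => simp
  | add a b _ _ ha hb => rw [map_add, LinearMap.add_apply, ha, hb, add_zero]
  | mem β u hu =>
    refine killingForm_rootSpace_eq_zero (fun h ↦ ?_) hu hqα
    have h1 := β.2
    rw [← sub_eq_add_neg, sub_eq_zero] at h
    rw [h] at h1
    linarith

/-- In a minimal parabolic subalgebra, root vectors for opposite roots do not both occur. -/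
theorem IsMinimalParabolic.eq_zero_of_mem_neg (hT : IsMaximalSplitTorus T)
    (hP : IsMinimalParabolic P) (hTP : T ≤ P) {α : Module.Dual ℚ T} (hα : α ≠ 0) {x z : 𝔤}
    (hx : x ∈ P) (hxα : x ∈ rootSpace T α) (hx0 : x ≠ 0) (hz : z ∈ P)
    (hzα : z ∈ rootSpace T (-α)) : z = 0 := by
  have h0 := hP.1.rootSpace_zero_le hT hTP
  -- The bracket lies in `𝔤_0` and is orthogonal to `𝔤_0`. The coroot of `x` makes `ad x` injective
  -- on `𝔤_{-α}`, so `z = 0`.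
  have hxz : ⁅x, z⁆ = 0 := by
    refine hT.1.eq_zero_of_mem_rootSpace (α := 0)
      (by simpa only [add_neg_cancel] using lie_mem_rootSpace hxα hzα) fun w hw ↦ ?_
    rw [neg_zero] at hw
    rw [killingForm_lie]
    exact hP.killingForm_eq_zero hT hTP hα hx hxα (P.lie_mem hz (h0 hw))
      (by simpa only [add_zero] using lie_mem_rootSpace hzα hw)
  obtain ⟨t, ht, htβ⟩ := hT.exists_coroot hα hxα hx0
  exact htβ (-α) (by rw [LinearMap.neg_apply, ht]; norm_num) z hzα hxz

/-- If a minimal parabolic subalgebra contains no nonzero root vector for `-α`, it contains the root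
space of `α`. -/
theorem IsMinimalParabolic.rootSpace_le (hT : IsMaximalSplitTorus T)
    (hP : IsMinimalParabolic P) (hTP : T ≤ P) {α : Module.Dual ℚ T}
    (h : ∀ z ∈ P, z ∈ rootSpace T (-α) → z = 0) : rootSpace T α ≤ P.toSubmodule := by
  intro v hv
  refine mem_of_killingForm_eq_zero fun n hn ↦ ?_
  suffices hle : killingPerp P.toSubmodule ≤ killingPerp (rootSpace T α) from hle hn v hv
  refine hT.1.le_of_inf_rootSpace_le
    (fun t ht v hv ↦ lie_mem_killingPerp (fun q hq ↦ P.lie_mem (hTP ht) hq) hv) fun β w hw hwP ↦ ?_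
  by_cases hβ : β + α = 0
  · rw [eq_neg_of_add_eq_zero_left hβ] at hw
    rw [h w (hP.1.mem_and_isNilpotent hwP).1 hw]
    exact Submodule.zero_mem _
  · exact fun q hq ↦ killingForm_rootSpace_eq_zero hβ hw hq

end Parabolic

/-! ### Positive systems, simple roots and generation of `𝔤`. -/

section Roots

variable {𝔤 : Type*} [LieRing 𝔤] [LieAlgebra ℚ 𝔤]

/-- A set of roots containing one of each pair `±α`, none of whose nonempty sums vanish. -/
structure IsPositiveSystem (T : LieSubalgebra ℚ 𝔤) (S : Set (Module.Dual ℚ T)) : Prop where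
  subset_rootSet : S ⊆ rootSet T
  mem_or_neg_mem : ∀ α ∈ rootSet T, α ∈ S ∨ -α ∈ S
  add_ne_zero : ∀ α ∈ S, ∀ β ∈ AddSubmonoid.closure S, α + β ≠ 0

/-- The elements of `S` that are not the sum of two elements of `S`. -/
def indecomposables {M : Type*} [Add M] (S : Set M) : Set M :=
  {α | α ∈ S ∧ ∀ β ∈ S, ∀ γ ∈ S, α ≠ β + γ}

variable {T P : LieSubalgebra ℚ 𝔤} {S : Set (Module.Dual ℚ T)}

lemma exists_ne_zero_of_mem_rootSet {α : Module.Dual ℚ T} (hα : α ∈ rootSet T) :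
    ∃ x ∈ rootSpace T α, x ≠ 0 := Submodule.exists_mem_ne_zero_of_ne_bot hα.2

lemma mem_rootSet_of_mem {α : Module.Dual ℚ T} {x : 𝔤} (hα : α ≠ 0) (hx : x ∈ rootSpace T α)
    (hx0 : x ≠ 0) : α ∈ rootSet T :=
  ⟨hα, fun h ↦ hx0 (by rwa [h, Submodule.mem_bot] at hx)⟩

/-- Difference of distinct indecomposable positive roots is not a root. -/
lemma IsPositiveSystem.lie_eq_zero (hS : IsPositiveSystem T S) {α β : Module.Dual ℚ T}
    (hα : α ∈ indecomposables S) (hβ : β ∈ indecomposables S) (hαβ : α ≠ β) {x y : 𝔤}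
    (hx : x ∈ rootSpace T α) (hy : y ∈ rootSpace T (-β)) : ⁅x, y⁆ = 0 := by
  by_contra h0
  have hroot : α + -β ∈ rootSet T := by
    refine mem_rootSet_of_mem ?_ (lie_mem_rootSpace hx hy) h0
    rwa [← sub_eq_add_neg, sub_ne_zero]
  rcases hS.mem_or_neg_mem _ hroot with h | h
  · exact hα.2 _ h β hβ.1 (by abel)
  · exact hβ.2 _ h α hα.1 (by abel)

variable [FiniteDimensional ℚ 𝔤]

/-- Well-founded induction over a positive system. -/
lemma IsPositiveSystem.induction (hT : IsSplitTorus T) (hS : IsPositiveSystem T S)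
    {p : Module.Dual ℚ T → Prop}
    (h : ∀ α ∈ S, (∀ β ∈ S, ∀ γ ∈ S, α = β + γ → p β) → p α) {α : Module.Dual ℚ T}
    (hα : α ∈ S) : p α := by
  -- The difference is a nonempty sum from `S`. Irreflexivity is the non-vanishing of such sums, and
  -- finiteness of `S` gives well-foundedness.
  let r : Module.Dual ℚ T → Module.Dual ℚ T → Prop := fun β α ↦
    ∃ γ ∈ S, ∃ δ ∈ AddSubmonoid.closure S, α = β + (γ + δ)
  have hr : IsStrictOrder (Module.Dual ℚ T) r :=
    { irrefl := fun α ⟨γ, hγ, δ, hδ, h⟩ ↦ hS.add_ne_zero γ hγ δ hδ (left_eq_add.mp h)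
      trans := by
        rintro a b c ⟨γ, hγ, δ, hδ, rfl⟩ ⟨γ', hγ', δ', hδ', rfl⟩
        refine ⟨γ, hγ, δ + (γ' + δ'), ?_, by abel⟩
        exact add_mem hδ (add_mem (AddSubmonoid.subset_closure hγ') hδ') }
  have hfin : S.Finite := hT.finite_rootSpace_ne_bot.subset fun α hα ↦ (hS.subset_rootSet hα).2
  refine (hfin.wellFoundedOn (r := r)).induction hα fun α hα ih ↦ h α hα fun β hβ γ hγ hαβ ↦ ?_
  exact ih β hβ ⟨γ, hγ, 0, zero_mem _, by rw [add_zero]; exact hαβ⟩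

lemma IsPositiveSystem.mem_closure_indecomposables (hT : IsSplitTorus T)
    (hS : IsPositiveSystem T S) {α : Module.Dual ℚ T} (hα : α ∈ S) :
    α ∈ AddSubmonoid.closure (indecomposables S) := by
  refine hS.induction hT (p := (· ∈ AddSubmonoid.closure (indecomposables S)))
    (fun α hα ih ↦ ?_) hα
  by_cases hi : α ∈ indecomposables S
  · exact AddSubmonoid.subset_closure hi
  · obtain ⟨β, hβ, γ, hγ, h⟩ : ∃ β ∈ S, ∃ γ ∈ S, α = β + γ := by
      by_contra! hne
      exact hi ⟨hα, hne⟩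
    rw [h]
    exact add_mem (ih β hβ γ hγ h) (ih γ hγ β hβ (by rw [h, add_comm]))

variable [LieAlgebra.IsKilling ℚ 𝔤]

lemma neg_mem_rootSet (hT : IsSplitTorus T) {α : Module.Dual ℚ T} (hα : α ∈ rootSet T) :
    -α ∈ rootSet T := ⟨neg_ne_zero.mpr hα.1, hT.rootSpace_neg_ne_bot hα.2⟩

open scoped Pointwise in
lemma IsPositiveSystem.neg (hT : IsSplitTorus T) (hS : IsPositiveSystem T S) :
    IsPositiveSystem T (-S) where
  subset_rootSet := fun α hα ↦ by
    simpa using neg_mem_rootSet hT (hS.subset_rootSet (Set.mem_neg.mp hα))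
  mem_or_neg_mem := fun α hα ↦ by
    simpa [or_comm] using hS.mem_or_neg_mem α hα
  add_ne_zero := fun α hα β hβ h ↦ by
    have hβ' : -β ∈ AddSubmonoid.closure S := by
      clear h
      induction hβ using AddSubmonoid.closure_induction with
      | mem γ hγ => exact AddSubmonoid.subset_closure hγ
      | zero => simp
      | add a b _ _ ha hb => rw [neg_add]; exact add_mem ha hb
    exact hS.add_ne_zero _ hα _ hβ' (by rw [← neg_add, h, neg_zero])

open scoped Pointwise in
omit [FiniteDimensional ℚ 𝔤] [LieAlgebra.IsKilling ℚ 𝔤] in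
lemma neg_mem_indecomposables {α : Module.Dual ℚ T} (h : α ∈ indecomposables (-S)) :
    -α ∈ indecomposables S :=
  ⟨h.1, fun β hβ γ hγ hαβ ↦ h.2 (-β) (by simpa using hβ) (-γ) (by simpa using hγ)
    (by rw [← neg_add, ← hαβ, neg_neg])⟩

/-- A subalgebra containing the centralizer of the torus and the root spaces of the indecomposable
positive roots contains all positive root spaces. -/
theorem IsPositiveSystem.rootSpace_le (hT : IsMaximalSplitTorus T) (hS : IsPositiveSystem T S)
    {N : LieSubalgebra ℚ 𝔤} (h0 : rootSpace T 0 ≤ N.toSubmodule)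
    (hN : ∀ α ∈ indecomposables S, rootSpace T α ≤ N.toSubmodule) {α : Module.Dual ℚ T}
    (hα : α ∈ S) : rootSpace T α ≤ N.toSubmodule := by
  refine hS.induction hT.1 (p := fun α ↦ rootSpace T α ≤ N.toSubmodule) (fun α hα ih ↦ ?_) hα
  intro x hx
  suffices h : x ∈ N.toSubmodule ⊓ rootSpace T α from h.1
  refine hT.1.mem_of_mem_rootSpace hx inf_le_right fun y hy hyN ↦ ?_
  suffices h : y = 0 by rw [h, map_zero, LinearMap.zero_apply]
  by_contra hy0
  have hα0 : α ≠ 0 := (hS.subset_rootSet hα).1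
  -- Here `α t = -2` and `α` is a sum of indecomposables, so some indecomposable `β` is negative on
  -- `t` and `ad y` is injective on `𝔤_β`. But `ad y` kills `𝔤_β`: for `w ∈ 𝔤_{α-β}`, `κ([y, z], w)
  -- = κ(y, [z, w])`, where `[z, w] ∈ N` by induction.
  obtain ⟨t, ht, hinj⟩ := hT.exists_coroot (neg_ne_zero.mpr hα0) hy hy0
  obtain ⟨β, hβ, hβt⟩ : ∃ β ∈ indecomposables S, β t < 0 := by
    by_contra! hnn
    have hle : AddSubmonoid.closure (indecomposables S) ≤
        (AddSubmonoid.nonneg ℚ).comap (LinearMap.applyₗ (R := ℚ) t).toAddMonoidHom :=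
      (AddSubmonoid.closure_le).mpr hnn
    have h1 : 0 ≤ α t := hle (hS.mem_closure_indecomposables hT.1 hα)
    rw [LinearMap.neg_apply] at ht
    linarith
  obtain ⟨z, hz, hz0⟩ := exists_ne_zero_of_mem_rootSet (hS.subset_rootSet hβ.1)
  refine hz0 (hinj β hβt z hz ?_)
  refine hT.1.eq_zero_of_mem_rootSpace (lie_mem_rootSpace hy hz) fun w hw ↦ ?_
  rcases eq_or_ne w 0 with rfl | hw0
  · exact map_zero _
  have hwN : w ∈ N := by
    rcases eq_or_ne (-(-α + β)) 0 with h | h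
    · rw [h] at hw
      exact h0 hw
    · rcases hS.mem_or_neg_mem _ (mem_rootSet_of_mem h hw hw0) with h | h
      · exact ih _ h β hβ.1 (by abel) hw
      · exact absurd (by abel) (hβ.2 _ h α hα)
  rw [killingForm_lie]
  refine hyN _ ⟨N.lie_mem (hN β hβ hz) hwN, ?_⟩
  have := lie_mem_rootSpace hz hw
  rwa [show β + -(-α + β) = α by abel] at this

/-- The subalgebra generated by the centralizer of a maximal split torus and the root spaces of the
indecomposable roots and their negatives is everything. -/
theorem IsPositiveSystem.eq_top (hT : IsMaximalSplitTorus T) (hS : IsPositiveSystem T S)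
    {N : LieSubalgebra ℚ 𝔤} (h0 : rootSpace T 0 ≤ N.toSubmodule)
    (hN : ∀ α ∈ indecomposables S, rootSpace T α ≤ N.toSubmodule)
    (hN' : ∀ α ∈ indecomposables S, rootSpace T (-α) ≤ N.toSubmodule) (x : 𝔤) : x ∈ N := by
  have hle : (⨆ α : Module.Dual ℚ T, rootSpace T α) ≤ N.toSubmodule := by
    refine iSup_le fun α ↦ ?_
    rcases eq_or_ne α 0 with rfl | hα
    · exact h0
    by_cases hb : rootSpace T α = ⊥
    · rw [hb]; exact bot_le
    rcases hS.mem_or_neg_mem α ⟨hα, hb⟩ with h | h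
    · exact hS.rootSpace_le hT h0 hN h
    · refine (hS.neg hT.1).rootSpace_le hT h0 (fun β hβ ↦ ?_) (Set.mem_neg.mpr h)
      have := hN' _ (neg_mem_indecomposables hβ)
      rwa [neg_neg] at this
  rw [hT.1.iSup_rootSpace] at hle
  exact hle Submodule.mem_top

lemma IsMinimalParabolic.mem_positiveRoots (hT : IsMaximalSplitTorus T)
    (hP : IsMinimalParabolic P) (hTP : T ≤ P) {α : Module.Dual ℚ T} (hα : α ≠ 0) {x : 𝔤}
    (hx : x ∈ P) (hxα : x ∈ rootSpace T α) (hx0 : x ≠ 0) : α ∈ positiveRoots T P :=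
  ⟨mem_rootSet_of_mem hα hxα hx0, hP.rootSpace_le hT hTP fun _ hz hzα ↦
    hP.eq_zero_of_mem_neg hT hTP hα hx hxα hx0 hz hzα⟩

lemma IsMinimalParabolic.neg_notMem_positiveRoots (hT : IsMaximalSplitTorus T)
    (hP : IsMinimalParabolic P) (hTP : T ≤ P) {α : Module.Dual ℚ T} (hα : α ∈ positiveRoots T P) :
    -α ∉ positiveRoots T P := by
  intro h
  obtain ⟨x, hx, hx0⟩ := exists_ne_zero_of_mem_rootSet hα.1
  obtain ⟨z, hz, hz0⟩ := exists_ne_zero_of_mem_rootSet h.1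
  exact hz0 (hP.eq_zero_of_mem_neg hT hTP hα.1.1 (hα.2 hx) hx hx0 (h.2 hz) hz)

/-- If the sum vanished, some `β` in `m` would be negative on the coroot of `α`. Then `[x, z] ≠ 0`
for nonzero `z ∈ 𝔤_β`, so `α + β` is again a positive root, and replacing `α` by it shortens `m`. -/
lemma IsMinimalParabolic.sum_ne_zero (hT : IsMaximalSplitTorus T)
    (hP : IsMinimalParabolic P) (hTP : T ≤ P) (n : ℕ) (α : Module.Dual ℚ T)
    (hα : α ∈ positiveRoots T P) (m : Multiset (Module.Dual ℚ T)) (hcard : m.card = n)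
    (hm : ∀ β ∈ m, β ∈ positiveRoots T P) : α + m.sum ≠ 0 := by
  induction n generalizing α m with
  | zero =>
    rw [Multiset.card_eq_zero.mp hcard, Multiset.sum_zero, add_zero]
    exact hα.1.1
  | succ n ih =>
    intro hsum
    obtain ⟨x, hx, hx0⟩ := exists_ne_zero_of_mem_rootSet hα.1
    obtain ⟨t, ht, hinj⟩ := hT.exists_coroot hα.1.1 hx hx0
    obtain ⟨β, hβm, hβt⟩ : ∃ β ∈ m, β t < 0 := by
      by_contra! hnn
      have h1 : 0 ≤ m.sum t := by
        rw [← LinearMap.applyₗ_apply_apply (R := ℚ) t, map_multiset_sum]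
        exact Multiset.sum_nonneg (by simpa using hnn)
      have h2 := congrArg (fun f : Module.Dual ℚ T ↦ f t) hsum
      simp only [LinearMap.add_apply, LinearMap.zero_apply] at h2
      linarith
    obtain ⟨m', rfl⟩ := Multiset.exists_cons_of_mem hβm
    have hβ := hm β hβm
    obtain ⟨z, hz, hz0⟩ := exists_ne_zero_of_mem_rootSet hβ.1
    have hxz : ⁅x, z⁆ ≠ 0 := fun h ↦ hz0 (hinj β hβt z hz h)
    have hne : α + β ≠ 0 := fun h ↦ hP.neg_notMem_positiveRoots hT hTP hα
      (by rwa [← eq_neg_of_add_eq_zero_right h])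
    refine ih (α + β) (hP.mem_positiveRoots hT hTP hne (P.lie_mem (hα.2 hx) (hβ.2 hz))
      (lie_mem_rootSpace hx hz) hxz) m' (by simpa using hcard)
      (fun γ hγ ↦ hm γ (Multiset.mem_cons_of_mem hγ)) ?_
    rw [← hsum, Multiset.sum_cons, add_assoc]

theorem IsMinimalParabolic.isPositiveSystem (hT : IsMaximalSplitTorus T)
    (hP : IsMinimalParabolic P) (hTP : T ≤ P) : IsPositiveSystem T (positiveRoots T P) where
  subset_rootSet := fun _ hα ↦ hα.1
  mem_or_neg_mem := fun α hα ↦ by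
    by_cases h : ∀ z ∈ P, z ∈ rootSpace T (-α) → z = 0
    · exact Or.inl ⟨hα, hP.rootSpace_le hT hTP h⟩
    · push Not at h
      obtain ⟨z, hz, hzα, hz0⟩ := h
      exact Or.inr (hP.mem_positiveRoots hT hTP (neg_ne_zero.mpr hα.1) hz hzα hz0)
  add_ne_zero := fun α hα β hβ ↦ by
    obtain ⟨m, hm, rfl⟩ := AddSubmonoid.exists_multiset_of_mem_closure hβ
    exact hP.sum_ne_zero hT hTP _ α hα m rfl hm

end Roots

/-! ### Rational forms and extension of scalars to `ℝ`. -/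

section RationalForms

variable {W : Type*} [AddCommGroup W] [Module ℚ W]

/-- The contraction `r ⊗ w ↦ φ r • w` of a real tensor along a rational functional. -/
noncomputable def contract (φ : Module.Dual ℚ ℝ) : ℝ ⊗[ℚ] W →ₗ[ℚ] W :=
  (TensorProduct.lid ℚ W).toLinearMap ∘ₗ φ.rTensor W

@[simp] lemma contract_tmul (φ : Module.Dual ℚ ℝ) (r : ℝ) (w : W) :
    contract φ (r ⊗ₜ w) = φ r • w := by
  simp [contract]

lemma contract_lTensor {W' : Type*} [AddCommGroup W'] [Module ℚ W'] (φ : Module.Dual ℚ ℝ)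
    (f : W →ₗ[ℚ] W') (z : ℝ ⊗[ℚ] W) : contract φ (f.lTensor ℝ z) = f (contract φ z) := by
  induction z using TensorProduct.induction_on with
  | zero => simp
  | tmul r w => simp
  | add a b ha hb => simp only [map_add, ha, hb]

/-- Contraction applies `φ` to the real coordinates of `z`, and rational functionals separate the
points of `ℝ`. -/
lemma eq_zero_of_contract_eq_zero {z : ℝ ⊗[ℚ] W} (h : ∀ φ, contract φ z = 0) : z = 0 := by
  let e := Module.Free.chooseBasis ℚ W
  have hrepr : ∀ (φ : Module.Dual ℚ ℝ) (z : ℝ ⊗[ℚ] W) i,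
      φ ((e.baseChange ℝ).repr z i) = e.repr (contract φ z) i := by
    intro φ z i
    induction z using TensorProduct.induction_on with
    | zero => simp
    | tmul r w => simp [mul_comm]
    | add a b ha hb => simp only [map_add, Finsupp.add_apply, ha, hb]
  refine (e.baseChange ℝ).repr.map_eq_zero_iff.mp (Finsupp.ext fun i ↦ ?_)
  refine (Module.forall_dual_apply_eq_zero_iff ℚ _).mp fun φ ↦ ?_
  rw [hrepr, h, map_zero, Finsupp.zero_apply]

variable {V : Type*} [AddCommGroup V] [Module ℝ V] [Module ℚ V] [IsScalarTower ℚ ℝ V]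

lemma liftBaseChange_lTensor {U W : Submodule ℚ V} (f : W →ₗ[ℚ] U) (g : Module.End ℝ V)
    (hfg : ∀ w, (f w : V) = g w) (z : ℝ ⊗[ℚ] W) :
    U.subtype.liftBaseChange ℝ (f.lTensor ℝ z) = g (W.subtype.liftBaseChange ℝ z) := by
  induction z using TensorProduct.induction_on with
  | zero => simp
  | tmul r w => simp [hfg]
  | add a b ha hb => simp only [map_add, ha, hb]

/-- Together with `isRationalForm_of_injective`, this replaces bases by a basis-free condition on `ℝ
⊗ U → V`. -/
lemma IsRationalForm.injective {E : Submodule ℝ V} {U : Submodule ℚ V} (hU : IsRationalForm E U) :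
    Function.Injective (U.subtype.liftBaseChange ℝ) := by
  obtain ⟨b, hb, -, rfl⟩ := hU
  have hb' : LinearIndependent ℝ ((↑) : b → V) := hb
  rw [← Subtype.range_coe (s := b)]
  let e := Module.Basis.span (hb'.restrict_scalars' ℚ)
  have hcomb : (Submodule.span ℚ (Set.range ((↑) : b → V))).subtype.liftBaseChange ℝ =
      Finsupp.linearCombination ℝ ((↑) : b → V) ∘ₗ (e.baseChange ℝ).repr.toLinearMap :=
    (e.baseChange ℝ).ext fun i ↦ by
      rw [LinearMap.comp_apply, LinearEquiv.coe_coe, Module.Basis.repr_self,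
        Finsupp.linearCombination_single, one_smul]
      simp [e, Module.Basis.span_apply]
  intro z z' h
  rw [hcomb] at h
  exact (e.baseChange ℝ).repr.injective (hb' h)

lemma isRationalForm_of_injective {W : Submodule ℚ V}
    (hW : Function.Injective (W.subtype.liftBaseChange ℝ)) :
    IsRationalForm (Submodule.span ℝ (W : Set V)) W := by
  let e := Module.Free.chooseBasis ℚ W
  have hrange : Submodule.span ℚ (Set.range fun i ↦ (e i : V)) = W := by
    have := congrArg (Submodule.map W.subtype) e.span_eq
    rw [Submodule.map_span, Submodule.map_subtype_top, ← Set.range_comp] at this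
    exact this
  have hli : LinearIndependent ℝ fun i ↦ (e i : V) := by
    have := (e.baseChange ℝ).linearIndependent.map' _ (LinearMap.ker_eq_bot.mpr hW)
    have hfun : (W.subtype.liftBaseChange ℝ ∘ e.baseChange ℝ) = fun i ↦ (e i : V) := by
      ext i; simp
    rwa [hfun] at this
  refine ⟨_, hli.linearIndepOn_id, ?_, hrange⟩
  conv_rhs => rw [← hrange]
  exact (Submodule.span_span_of_tower ℚ ℝ _).symm

end RationalForms

/-! ### The span of lowering words, weights, and irreducibility. -/

section Representations

variable {𝔤 : Type*} [LieRing 𝔤] [LieAlgebra ℚ 𝔤] {T P : LieSubalgebra ℚ 𝔤}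
variable {V : Type*} [AddCommGroup V] [Module ℝ V] [Module ℚ V] [IsScalarTower ℚ ℝ V]
variable {ρ : 𝔤 →ₗ⁅ℚ⁆ Module.End ℝ V}

lemma map_lie_apply (x y : 𝔤) (v : V) : ρ ⁅x, y⁆ v = ρ x (ρ y v) - ρ y (ρ x v) := by
  rw [LieHom.map_lie, Ring.lie_def, LinearMap.sub_apply, Module.End.mul_apply, Module.End.mul_apply]

lemma map_map_apply (x y : 𝔤) (v : V) : ρ x (ρ y v) = ρ y (ρ x v) + ρ ⁅x, y⁆ v := by
  rw [map_lie_apply, add_sub_cancel]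

/-- The subalgebra of elements preserving a rational subspace. -/
def stabilizer (ρ : 𝔤 →ₗ⁅ℚ⁆ Module.End ℝ V) (W : Submodule ℚ V) : LieSubalgebra ℚ 𝔤 where
  carrier := {x | ∀ w ∈ W, ρ x w ∈ W}
  add_mem' := fun {x y} hx hy w hw ↦ by
    rw [map_add, LinearMap.add_apply]
    exact W.add_mem (hx w hw) (hy w hw)
  zero_mem' := fun w _ ↦ by rw [map_zero, LinearMap.zero_apply]; exact W.zero_mem
  smul_mem' := fun c x hx w hw ↦ by
    rw [map_smul, LinearMap.smul_apply]
    exact W.smul_mem c (hx w hw)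
  lie_mem' := fun {x y} hx hy w hw ↦ by
    rw [map_lie_apply]
    exact W.sub_mem (hx _ (hy w hw)) (hy _ (hx w hw))

variable {U : Submodule ℚ V}

lemma le_negativeSpan : U ≤ negativeSpan ρ T P U := fun u hu ↦
  Submodule.subset_span ⟨[], u, hu, by simp, by simp⟩

lemma map_mem_negativeSpan {α : Module.Dual ℚ T} (hα : α ∈ simpleRoots T P) {y : 𝔤}
    (hy : y ∈ rootSpace T (-α)) {w : V} (hw : w ∈ negativeSpan ρ T P U) :
    ρ y w ∈ negativeSpan ρ T P U := by
  induction hw using Submodule.span_induction with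
  | mem w hw =>
    obtain ⟨l, u, hu, hl, rfl⟩ := hw
    refine Submodule.subset_span ⟨y :: l, u, hu, ?_, by simp⟩
    intro z hz
    rcases List.mem_cons.mp hz with rfl | hz
    · exact ⟨α, hα, hy⟩
    · exact hl z hz
  | zero => rw [map_zero]; exact Submodule.zero_mem _
  | add a b _ _ ha hb => rw [map_add]; exact Submodule.add_mem _ ha hb
  | smul c a _ ha => rw [LinearMap.map_smul_of_tower]; exact Submodule.smul_mem _ c ha

lemma negativeSpan_le {p : Submodule ℚ V} (hU : U ≤ p)
    (h : ∀ α ∈ simpleRoots T P, ∀ y ∈ rootSpace T (-α), ∀ w ∈ negativeSpan ρ T P U, w ∈ p →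
      ρ y w ∈ p) : negativeSpan ρ T P U ≤ p := by
  refine Submodule.span_le.mpr ?_
  rintro _ ⟨l, u, hu, hl, rfl⟩
  induction l with
  | nil => simpa using hU hu
  | cons y l ih =>
    obtain ⟨α, hα, hy⟩ := hl y List.mem_cons_self
    have hl' := fun z hz ↦ hl z (List.mem_cons_of_mem y hz)
    rw [List.map_cons, List.prod_cons, Module.End.mul_apply]
    exact h α hα y hy _ (Submodule.subset_span ⟨l, u, hu, hl', rfl⟩) (ih hl')

/-- Move `x` past the leftmost letter: `x y w = y x w + [x, y] w`. Asking for `[x, y]` to act well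
on the whole span, not only on `U`, lets already established stability under `𝔤_0` be fed in. -/
lemma le_stabilizer_negativeSpan {M : Submodule ℚ 𝔤}
    (hM : ∀ x ∈ M, ∀ u ∈ U, ρ x u ∈ U)
    (hlie : ∀ α ∈ simpleRoots T P, ∀ y ∈ rootSpace T (-α), ∀ x ∈ M, ∀ w ∈ negativeSpan ρ T P U,
      ρ ⁅x, y⁆ w ∈ negativeSpan ρ T P U) :
    M ≤ (stabilizer ρ (negativeSpan ρ T P U)).toSubmodule := by
  let p : Submodule ℚ V :=
    { carrier := {w | ∀ x ∈ M, ρ x w ∈ negativeSpan ρ T P U}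
      add_mem' := fun {a b} ha hb x hx ↦ by
        rw [map_add]; exact Submodule.add_mem _ (ha x hx) (hb x hx)
      zero_mem' := fun x _ ↦ by rw [map_zero]; exact Submodule.zero_mem _
      smul_mem' := fun c a ha x hx ↦ by
        rw [LinearMap.map_smul_of_tower]; exact Submodule.smul_mem _ c (ha x hx) }
  have hp : negativeSpan ρ T P U ≤ p := by
    refine negativeSpan_le (fun u hu x hx ↦ le_negativeSpan (hM x hx u hu))
      fun α hα y hy w hw hwp x hx ↦ ?_
    rw [map_map_apply]
    exact Submodule.add_mem _ (map_mem_negativeSpan hα hy (hwp x hx)) (hlie α hα y hy x hx w hw)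
  exact fun x hx w hw ↦ hp hw x hx

/-- The rational span of the lowering words applied to `U` is `𝔤`-invariant. -/
theorem map_mem_negativeSpan_of_isMinimalParabolic [FiniteDimensional ℚ 𝔤]
    [LieAlgebra.IsKilling ℚ 𝔤]
    (hT : IsMaximalSplitTorus T) (hP : IsMinimalParabolic P) (hTP : T ≤ P)
    (hPU : ∀ x ∈ P, ∀ u ∈ U, ρ x u ∈ U) (x : 𝔤) {w : V} (hw : w ∈ negativeSpan ρ T P U) :
    ρ x w ∈ negativeSpan ρ T P U := by
  have hS := hP.isPositiveSystem hT hTP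
  have hP0 := hP.1.rootSpace_zero_le hT hTP
  have h0 : rootSpace T 0 ≤ (stabilizer ρ (negativeSpan ρ T P U)).toSubmodule := by
    refine le_stabilizer_negativeSpan (fun x hx ↦ hPU x (hP0 hx)) fun α hα y hy x hx w hw ↦ ?_
    refine map_mem_negativeSpan hα ?_ hw
    simpa only [zero_add] using lie_mem_rootSpace hx hy
  -- `simpleRoots T P` is by definition `indecomposables (positiveRoots T P)`.
  refine hS.eq_top hT h0 (fun α hα ↦ ?_) (fun α hα y hy w hw ↦ map_mem_negativeSpan hα hy hw) x w hw
  refine le_stabilizer_negativeSpan (fun x hx ↦ hPU x (hα.1.2 hx)) fun β hβ y hy x hx w hw ↦ ?_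
  rcases eq_or_ne α β with rfl | hαβ
  · exact h0 (by simpa only [add_neg_cancel] using lie_mem_rootSpace hx hy) w hw
  · rw [hS.lie_eq_zero hα hβ hαβ hx hy, map_zero, LinearMap.zero_apply]
    exact Submodule.zero_mem _

lemma mem_weightSpace {μ : T → ℝ} {v : V} :
    v ∈ weightSpace ρ T μ ↔ ∀ t : T, ρ (t : 𝔤) v = μ t • v := by
  simp [weightSpace, Submodule.mem_iInf]

lemma map_mem_weightSpace {α : Module.Dual ℚ T} {μ : T → ℝ} {x : 𝔤} {v : V}
    (hx : x ∈ rootSpace T α) (hv : v ∈ weightSpace ρ T μ) :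
    ρ x v ∈ weightSpace ρ T (fun t ↦ (α t : ℝ) + μ t) := by
  rw [mem_weightSpace] at hv ⊢
  intro t
  rw [map_map_apply, mem_rootSpace.mp hx t, hv t, map_smul, map_smul, LinearMap.smul_apply,
    add_smul, add_comm, Rat.cast_smul_eq_qsmul]

lemma iSupIndep_weightSpace (hT : IsSplitTorus T) :
    iSupIndep fun μ : T → ℝ ↦ weightSpace ρ T μ :=
  iSupIndep_iInf_eigenspace (fun t : T ↦ ρ (t : 𝔤)) fun s t ↦ by
    rw [commute_iff_lie_eq, ← LieHom.map_lie, hT.1 s s.2 t t.2, map_zero]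

/-- Root vectors shift weights, so the sum of all weight spaces is a nonzero invariant subspace.
Diagonalizability of `T` on `V` thus follows from a single weight. -/
lemma iSup_weightSpace [FiniteDimensional ℚ 𝔤] (hT : IsSplitTorus T) (hρ : IsIrreducibleRep ρ)
    {μ : T → ℝ} (hμ : weightSpace ρ T μ ≠ ⊥) : ⨆ ν : T → ℝ, weightSpace ρ T ν = ⊤ := by
  refine (hρ.2 _ fun x v hv ↦ ?_).resolve_left fun h ↦
    hμ (eq_bot_iff.mpr (h ▸ le_iSup (fun ν : T → ℝ ↦ weightSpace ρ T ν) μ))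
  have hx : x ∈ ⨆ α : Module.Dual ℚ T, rootSpace T α := hT.iSup_rootSpace ▸ Submodule.mem_top
  induction hx using Submodule.iSup_induction' with
  | zero => rw [map_zero, LinearMap.zero_apply]; exact Submodule.zero_mem _
  | add a b _ _ ha hb => rw [map_add, LinearMap.add_apply]; exact Submodule.add_mem _ ha hb
  | mem α x hx =>
    induction hv using Submodule.iSup_induction' with
    | zero => rw [map_zero]; exact Submodule.zero_mem _
    | add a b _ _ ha hb => rw [map_add]; exact Submodule.add_mem _ ha hb
    | mem ν v hv =>
      exact (le_iSup (fun ν : T → ℝ ↦ weightSpace ρ T ν) _) (map_mem_weightSpace hx hv)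

/-- The span of the weight spaces below `l` lies in any sum of weight spaces avoiding `l`; the
lowering words applied to `U` lie in `U` modulo that span. -/
lemma negativeSpan_le_sup {S : Set (Module.Dual ℚ T)} (hS : IsPositiveSystem T S)
    (hSP : simpleRoots T P ⊆ S) (l : Module.Dual ℚ T)
    (hU : ∀ u ∈ U, u ∈ weightSpace ρ T fun t ↦ (l t : ℝ)) :
    negativeSpan ρ T P U ≤ U ⊔ (⨆ ν : T → ℝ, ⨆ _ : ν ≠ fun t ↦ (l t : ℝ),
      weightSpace ρ T ν).restrictScalars ℚ := by
  -- `D` collects the weights `l - s` with `s` a nonempty sum from `S`. Lowering operators map both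
  -- `U` and `D` into `D`, and `s ≠ 0` by positivity.
  let D : Submodule ℝ V :=
    ⨆ s : {s // ∃ α ∈ S, ∃ β ∈ AddSubmonoid.closure S, s = α + β},
      weightSpace ρ T fun t ↦ ((l - s : Module.Dual ℚ T) t : ℝ)
  have hmem : ∀ α ∈ S, ∀ β ∈ AddSubmonoid.closure S, ∀ v ∈ weightSpace ρ T
      (fun t ↦ ((l - (α + β) : Module.Dual ℚ T) t : ℝ)), v ∈ D := fun α hα β hβ v hv ↦
    (le_iSup (fun s : {s // ∃ α ∈ S, ∃ β ∈ AddSubmonoid.closure S, s = α + β} ↦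
      weightSpace ρ T fun t ↦ ((l - s : Module.Dual ℚ T) t : ℝ))) ⟨α + β, α, hα, β, hβ, rfl⟩ hv
  have hD : D ≤ ⨆ ν : T → ℝ, ⨆ _ : ν ≠ fun t ↦ (l t : ℝ), weightSpace ρ T ν := by
    refine iSup_le fun ⟨s, α, hα, β, hβ, hs⟩ ↦ le_iSup₂_of_le _ (fun h ↦ ?_) le_rfl
    refine hS.add_ne_zero α hα β hβ (LinearMap.ext fun t ↦ ?_)
    have h1 : (l - s) t = l t := by exact_mod_cast congrFun h t
    rw [LinearMap.sub_apply] at h1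
    rw [← hs, LinearMap.zero_apply]
    linarith
  have hle : negativeSpan ρ T P U ≤ U ⊔ D.restrictScalars ℚ := by
    refine negativeSpan_le le_sup_left fun α hα y hy w _ hw ↦ ?_
    obtain ⟨u, hu, d, hd, hw⟩ := Submodule.mem_sup.mp hw
    refine le_sup_right (a := U) ?_
    rw [← hw, map_add]
    refine Submodule.add_mem _ ?_ ?_
    · refine hmem α (hSP hα) 0 (zero_mem _) _ ?_
      convert map_mem_weightSpace hy (hU u hu) using 2
      ext t
      simp; ring
    · change d ∈ D at hd
      change ρ y d ∈ D
      clear hw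
      induction hd using Submodule.iSup_induction' with
      | zero => rw [map_zero]; exact Submodule.zero_mem _
      | add a b _ _ ha hb => rw [map_add]; exact Submodule.add_mem _ ha hb
      | mem s d hd =>
        obtain ⟨s, β, hβ, γ, hγ, rfl⟩ := s
        refine hmem α (hSP hα) (β + γ)
          (add_mem (AddSubmonoid.subset_closure hβ) hγ) _ ?_
        convert map_mem_weightSpace hy hd using 2
        ext t
        simp; ring
  exact hle.trans (sup_le_sup_left (show D.restrictScalars ℚ ≤ _ from hD) U)

/-- An invariant rational subspace of an irreducible real representation is a rational form of its
real span if a nonzero real endomorphism maps it into a rational form of some subspace. -/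
theorem IsIrreducibleRep.injective_liftBaseChange (hρ : IsIrreducibleRep ρ) {W : Submodule ℚ V}
    (hW : ∀ x, ∀ w ∈ W, ρ x w ∈ W) (g : Module.End ℝ V) (hg : g ≠ 0) (hgW : ∀ w ∈ W, g w ∈ U)
    (hU : Function.Injective (U.subtype.liftBaseChange ℝ)) :
    Function.Injective (W.subtype.liftBaseChange ℝ) := by
  let restr : 𝔤 → (W →ₗ[ℚ] W) := fun x ↦ ((ρ x).restrictScalars ℚ).restrict (hW x)
  let gr : W →ₗ[ℚ] U := ((g.restrictScalars ℚ).restrict hgW)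
  refine (injective_iff_map_eq_zero _).mpr fun z hz ↦ eq_zero_of_contract_eq_zero fun φ ↦ ?_
  -- Contraction commutes with `ρ x`, so `K` is invariant. It also commutes with `g`, which sends
  -- relations in `W` to relations in `U`, and those are trivial; so `K` lies in the kernel of `g`
  -- and is proper.
  let K : Submodule ℝ V := Submodule.span ℝ {v | ∃ z : ℝ ⊗[ℚ] W,
    W.subtype.liftBaseChange ℝ z = 0 ∧ v = (contract φ z : W)}
  have hK : ∀ x, ∀ v ∈ K, ρ x v ∈ K := by
    intro x v hv
    induction hv using Submodule.span_induction with
    | mem v hv =>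
      obtain ⟨z, hz, rfl⟩ := hv
      refine Submodule.subset_span ⟨(restr x).lTensor ℝ z, ?_, ?_⟩
      · rw [liftBaseChange_lTensor _ (ρ x) (fun w ↦ rfl), hz, map_zero]
      · rw [contract_lTensor]; rfl
    | zero => rw [map_zero]; exact Submodule.zero_mem _
    | add a b _ _ ha hb => rw [map_add]; exact Submodule.add_mem _ ha hb
    | smul c a _ ha => rw [map_smul]; exact Submodule.smul_mem _ c ha
  have hKg : K ≤ LinearMap.ker g := by
    refine Submodule.span_le.mpr ?_
    rintro _ ⟨z, hz, rfl⟩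
    have h1 : gr.lTensor ℝ z = 0 := hU (by
      rw [liftBaseChange_lTensor _ g (fun w ↦ rfl), hz, map_zero, map_zero])
    have h2 := contract_lTensor φ gr z
    rw [h1, map_zero] at h2
    exact (congrArg ((↑) : U → V) h2).symm
  have hK0 : K = ⊥ := (hρ.2 K hK).resolve_right fun h ↦
    hg (LinearMap.ker_eq_top.mp (top_le_iff.mp (h ▸ hKg)))
  have hmem : ((contract φ z : W) : V) ∈ K := Submodule.subset_span ⟨z, hz, rfl⟩
  rw [hK0, Submodule.mem_bot] at hmem
  exact_mod_cast hmem

lemma IsIrreducibleRep.span_eq_top (hρ : IsIrreducibleRep ρ) {W : Submodule ℚ V}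
    (hW : ∀ x, ∀ w ∈ W, ρ x w ∈ W) (hW0 : W ≠ ⊥) : Submodule.span ℝ (W : Set V) = ⊤ := by
  refine (hρ.2 _ fun x v hv ↦ ?_).resolve_left fun h ↦ hW0 ?_
  · induction hv using Submodule.span_induction with
    | mem v hv => exact Submodule.subset_span (hW x v hv)
    | zero => rw [map_zero]; exact Submodule.zero_mem _
    | add a b _ _ ha hb => rw [map_add]; exact Submodule.add_mem _ ha hb
    | smul c a _ ha => rw [map_smul]; exact Submodule.smul_mem _ c ha
  · refine (Submodule.eq_bot_iff _).mpr fun w hw ↦ ?_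
    have : w ∈ Submodule.span ℝ (W : Set V) := Submodule.subset_span hw
    rwa [h, Submodule.mem_bot] at this

omit [IsScalarTower ℚ ℝ V] in
lemma IsRationalForm.ne_bot {E : Submodule ℝ V} (hU : IsRationalForm E U) (hE : E ≠ ⊥) :
    U ≠ ⊥ := by
  obtain ⟨b, -, rfl, rfl⟩ := hU
  intro h
  refine hE (Submodule.span_eq_bot.mpr fun x hx ↦ ?_)
  exact Submodule.span_eq_bot.mp h x hx

lemma IsRationalForm.mem {E : Submodule ℝ V} (hU : IsRationalForm E U) {u : V} (hu : u ∈ U) :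
    u ∈ E := by
  obtain ⟨b, -, rfl, rfl⟩ := hU
  exact Submodule.span_le_restrictScalars ℚ ℝ b hu

end Representations

end QForm

theorem mainTheorem8
    {𝔤 : Type*} [LieRing 𝔤] [LieAlgebra ℚ 𝔤] [FiniteDimensional ℚ 𝔤]
    [LieAlgebra.IsSemisimple ℚ 𝔤]
    (T P : LieSubalgebra ℚ 𝔤)
    (hT : QForm.IsMaximalSplitTorus T)
    (hP : QForm.IsMinimalParabolic P) (hTP : T ≤ P)
    {V : Type*} [AddCommGroup V] [Module ℝ V] [Module ℚ V] [IsScalarTower ℚ ℝ V]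
    [FiniteDimensional ℝ V]
    (ρ : 𝔤 →ₗ⁅ℚ⁆ Module.End ℝ V) (hρ : QForm.IsIrreducibleRep ρ)
    (l : Module.Dual ℚ T) (hl : QForm.IsHighestWeight ρ T P l)
    (U : Submodule ℚ V)
    (hU : QForm.IsRationalForm (QForm.weightSpace ρ T (fun t => (l t : ℝ))) U)
    (hPU : ∀ x ∈ P, ∀ u ∈ U, ρ x u ∈ U) :
    ∃ W : Submodule ℚ V,
      QForm.IsRationalFormOfRep ρ W ∧ W = QForm.negativeSpan ρ T P U := by
  have hS := hP.isPositiveSystem hT hTP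
  have hW : ∀ x, ∀ w ∈ QForm.negativeSpan ρ T P U, ρ x w ∈ QForm.negativeSpan ρ T P U :=
    fun x w hw ↦ QForm.map_mem_negativeSpan_of_isMinimalParabolic hT hP hTP hPU x hw
  have hW0 : QForm.negativeSpan ρ T P U ≠ ⊥ := fun h ↦
    hU.ne_bot hl.1 (eq_bot_iff.mpr (h ▸ QForm.le_negativeSpan))
  let l' : T → ℝ := fun t ↦ (l t : ℝ)
  -- The projection attached to this decomposition is the nonzero endomorphism that maps the span of
  -- lowering words into `U`.
  have hcompl : IsCompl (QForm.weightSpace ρ T l') (⨆ ν ≠ l', QForm.weightSpace ρ T ν) := by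
    refine ⟨QForm.iSupIndep_weightSpace hT.1 l', codisjoint_iff.mpr ?_⟩
    rw [← QForm.iSup_weightSpace hT.1 hρ hl.1, ← iSup_split_single]
  have hinj := hρ.injective_liftBaseChange hW (Submodule.projection _ _ hcompl) (fun h ↦ ?_)
    (fun w hw ↦ ?_) hU.injective
  · refine ⟨_, ⟨hW, ?_⟩, rfl⟩
    rw [← hρ.span_eq_top hW hW0]
    exact QForm.isRationalForm_of_injective hinj
  · refine hl.1 ?_
    rw [← Submodule.range_projection hcompl, h, LinearMap.range_zero]
  · obtain ⟨u, hu, d, hd, rfl⟩ := Submodule.mem_sup.mp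
      (QForm.negativeSpan_le_sup hS (fun α hα ↦ hα.1) l (fun u hu ↦ hU.mem hu) hw)
    rw [map_add, Submodule.projection_apply_of_mem_left hcompl (hU.mem hu),
      (Submodule.projection_apply_eq_zero_iff hcompl).mpr hd, add_zero]
    exact hu
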